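/- Let $K$ be a field. A \emph{weighted graph} $(E,w)$ consists of a directed graph $E=(E^0,E^1,s,r)$ (vertex set $E^0$, edge set $E^1$, source and range maps $s,r:E^1\to E^0$) and a map $w:E^1\to\{1,2,\dots\}$. Let $(E,w)$ be a weighted graph with $E^0\neq\emptyset$ that is row-finite, i.e. $s^{-1}(v)$ is finite for every $v\in E^0$; it is called \emph{finite} if $E^0$ and $E^1$ are finite. Put $w(v)=\max\{w(e)\mid e\in s^{-1}(v)\}$ for $v\in E^0$, with $\max\emptyset=0$. The \emph{weighted Leavitt path algebra} $L_K(E,w)$ is the associative (not necessarily unital) $K$-algebra generated by $E^0\cup\{e_i,e_i^*\mid e\in E^1,\,1\le i\le w(e)\}$ subject to the relations $uv=\delta_{uv}u$ for $u,v\in E^0$; $s(e)e_i=e_i=e_ir(e)$ and $r(e)e_i^*=e_i^*=e_i^*s(e)$ for $e\in E^1$, $1\le i\le w(e)$; $\sum_{e\in s^{-1}(v)}e_ie_j^*=\delta_{ij}v$ for $v\in E^0$, $1\le i,j\le w(v)$; and $\sum_{1\le i\le w(v)}e_i^*f_i=\delta_{ef}r(e)$ for $v\in E^0$, $e,f\in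 s^{-1}(v)$; here $e_i$ and $e_i^*$ are set to zero if $i>w(e)$. For a $K$-algebra $A$, $\operatorname{GKdim}A=\sup_U\limsup_{n\to\infty}\log\dim_K(U+U^2+\dots+U^n)/\log n$, where $U$ ranges over the finite-dimensional subspaces of $A$. A \emph{path} is either a single vertex or a nonempty word $x_1\cdots x_n$ of edges with $r(x_i)=s(x_{i+1})$ for $1\le i<n$. A \emph{cycle} based at $v$ is a path $x_1\cdots x_n$ of edges ($n\ge1$) with $s(x_1)=v=r(x_n)$ and pairwise distinct $s(x_1),\dots,s(x_n)$; $(E,w)$ is \emph{acyclic} if it has no cycle. Write $u\ge v$ if there is a path from $u$ to $v$, and $T(X)=\{v\mid u\ge v\text{ for some }u\in X\}$ for $X\subseteq E^0$, $T(u)=T(\{u\})$. Edges $e,f$ are \emph{in line} if $e=f$ or $r(e)\ge s(f)$ or $r(f)\ge s(e)$. An edge or vertex $x$ is \emph{weighted} if $w(x)>1$ and \emph{unweighted} otherwise; $E^1_w$ is the set of weighted edges. The weighted part of $(E,w)$ is \emph{well-behaved} if the following hold. \begin{enumerate} \item[(1)] No weighted vertex emits two distinct weighted edges. \item[(2)]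 No vertex $v\in T(r(E^1_w))$ emits two distinct edges. \item[(3)] If $e,f\in E^1_w$ are not in line, then $T(r(e))\cap T(r(f))=\emptyset$. \item[(4)] No cycle is based at a vertex $v\in T(r(E^1_w))$. \item[(5)] There are no $n\ge1$ and paths $p_1,\dots,p_n,q_1,\dots,q_n$ such that $p_i$ and $q_i$ end at the same vertex ($1\le i\le n$), $p_1$ and $q_n$ start at the same vertex, $p_i$ and $q_{i-1}$ start at the same vertex ($2\le i\le n$), and for every $i$ the first letter of $p_i$ is a weighted edge, the first letter of $q_i$ is an unweighted edge, and the last letters of $p_i$ and $q_i$ are distinct. \end{enumerate} \textbf{Theorem.} The following are equivalent: \begin{enumerate} \item[(i)] $L_K(E,w)$ is finite-dimensional over $K$. \item[(ii)] $(E,w)$ is finite and acyclic, and the weighted part of $(E,w)$ is well-behaved. \item[(iii)] $(E,w)$ is finite and $\operatorname{GKdim}L_K(E,w)=0$. \end{enumerate} -/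

import Mathlib

noncomputable section

/-! ### Not necessarily unital associative algebras over a field -/

section Algebras

variable (K : Type*) [Field K]

/-- The two-sided algebra ideal generated by a set `S`: the smallest `K`-subspace of `A` that
contains `S` and is closed under left and right multiplication by elements of `A`. -/
def algIdealGen {A : Type*} [NonUnitalRing A] [Module K A] (S : Set A) : Submodule K A :=
  sInf {I : Submodule K A | S ⊆ I ∧ ∀ a : A, ∀ x ∈ I, a * x ∈ I ∧ x * a ∈ I}

theorem subset_algIdealGen {A : Type*} [NonUnitalRing A] [Module K A] (S : Set A) :
    S ⊆ algIdealGen K S := by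
  intro x hx
  refine (Submodule.mem_sInf).2 ?_
  rintro I ⟨hS, -⟩
  exact hS hx

theorem mul_mem_algIdealGen {A : Type*} [NonUnitalRing A] [Module K A] (S : Set A) (a : A)
    {x : A} (hx : x ∈ algIdealGen K S) : a * x ∈ algIdealGen K S := by
  refine (Submodule.mem_sInf).2 fun I hI => ?_
  exact (hI.2 a x ((Submodule.mem_sInf).1 hx I hI)).1

theorem mem_algIdealGen_mul {A : Type*} [NonUnitalRing A] [Module K A] (S : Set A) (a : A)
    {x : A} (hx : x ∈ algIdealGen K S) : x * a ∈ algIdealGen K S := by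
  refine (Submodule.mem_sInf).2 fun I hI => ?_
  exact (hI.2 a x ((Submodule.mem_sInf).1 hx I hI)).2

/-- The quotient of the algebra `A` by the ideal generated by `S`. -/
def AlgQuotient {A : Type*} [NonUnitalRing A] [Module K A] (S : Set A) : Type _ :=
  A ⧸ algIdealGen K S

namespace AlgQuotient

variable {A : Type*} [NonUnitalRing A] [Module K A] (S : Set A)

instance instAddCommGroup : AddCommGroup (AlgQuotient K S) :=
  inferInstanceAs (AddCommGroup (A ⧸ algIdealGen K S))

instance instModule : Module K (AlgQuotient K S) :=
  inferInstanceAs (Module K (A ⧸ algIdealGen K S))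

/-- The quotient map. -/
def mk : A →ₗ[K] AlgQuotient K S := (algIdealGen K S).mkQ

theorem mk_surjective : Function.Surjective (mk K S) :=
  Submodule.mkQ_surjective _

theorem mk_eq_mk_iff (x y : A) : mk K S x = mk K S y ↔ x - y ∈ algIdealGen K S :=
  Submodule.Quotient.eq _

instance instMul : Mul (AlgQuotient K S) where
  mul x y := Quotient.liftOn₂' x y (fun a b => mk K S (a * b)) (by
    intro a b a' b' h h'
    have h1 : a - a' ∈ algIdealGen K S := (Submodule.quotientRel_def _).1 h
    have h2 : b - b' ∈ algIdealGen K S := (Submodule.quotientRel_def _).1 h'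
    refine (mk_eq_mk_iff K S _ _).2 ?_
    have h3 : a * b - a' * b' = (a - a') * b + a' * (b - b') := by
      rw [sub_mul, mul_sub]; abel
    rw [h3]
    exact add_mem (mem_algIdealGen_mul K S b h1) (mul_mem_algIdealGen K S a' h2))

theorem mk_mul (a b : A) : mk K S (a * b) = mk K S a * mk K S b := rfl

instance instNonUnitalRing : NonUnitalRing (AlgQuotient K S) :=
  { instAddCommGroup K S, instMul K S with
    left_distrib := by
      intro x y z
      obtain ⟨a, rfl⟩ := mk_surjective K S x
      obtain ⟨b, rfl⟩ := mk_surjective K S y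
      obtain ⟨c, rfl⟩ := mk_surjective K S z
      rw [← map_add, ← mk_mul, ← mk_mul, ← mk_mul, ← map_add, mul_add]
    right_distrib := by
      intro x y z
      obtain ⟨a, rfl⟩ := mk_surjective K S x
      obtain ⟨b, rfl⟩ := mk_surjective K S y
      obtain ⟨c, rfl⟩ := mk_surjective K S z
      rw [← map_add, ← mk_mul, ← mk_mul, ← mk_mul, ← map_add, add_mul]
    zero_mul := by
      intro x
      obtain ⟨a, rfl⟩ := mk_surjective K S x
      rw [← map_zero (mk K S), ← mk_mul, zero_mul]
    mul_zero := by
      intro x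
      obtain ⟨a, rfl⟩ := mk_surjective K S x
      rw [← map_zero (mk K S), ← mk_mul, mul_zero]
    mul_assoc := by
      intro x y z
      obtain ⟨a, rfl⟩ := mk_surjective K S x
      obtain ⟨b, rfl⟩ := mk_surjective K S y
      obtain ⟨c, rfl⟩ := mk_surjective K S z
      rw [← mk_mul, ← mk_mul, ← mk_mul, ← mk_mul, mul_assoc] }

instance instIsScalarTower [IsScalarTower K A A] :
    IsScalarTower K (AlgQuotient K S) (AlgQuotient K S) where
  smul_assoc := by
    intro k x y
    obtain ⟨a, rfl⟩ := mk_surjective K S x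
    obtain ⟨b, rfl⟩ := mk_surjective K S y
    rw [smul_eq_mul, smul_eq_mul, ← map_smul, ← mk_mul, ← mk_mul, ← map_smul, smul_mul_assoc]

instance instSMulCommClass [SMulCommClass K A A] :
    SMulCommClass K (AlgQuotient K S) (AlgQuotient K S) where
  smul_comm := by
    intro k x y
    obtain ⟨a, rfl⟩ := mk_surjective K S x
    obtain ⟨b, rfl⟩ := mk_surjective K S y
    rw [smul_eq_mul, smul_eq_mul, ← map_smul, ← mk_mul, ← mk_mul, ← map_smul, mul_smul_comm]

end AlgQuotient

/-- The free associative algebra `K⟨X⟩` without unit: the vector space with basis the nonempty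
words over `X`, multiplied by juxtaposition. -/
abbrev FreeAssocAlg (X : Type*) : Type _ := MonoidAlgebra K (FreeSemigroup X)

/-- The generator of `K⟨X⟩` given by the letter `x`. -/
def FreeAssocAlg.letter {X : Type*} (x : X) : FreeAssocAlg K X :=
  MonoidAlgebra.single (FreeSemigroup.of x) 1

/-- `powSubspace K U n` is `U ^ (n + 1)`, the linear span of all products of `n + 1` elements
of the subspace `U`. -/
def powSubspace {A : Type*} [NonUnitalRing A] [Module K A] [IsScalarTower K A A]
    [SMulCommClass K A A] (U : Submodule K A) : ℕ → Submodule K A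
  | 0 => U
  | n + 1 => Submodule.map₂ (LinearMap.mul K A) (powSubspace U n) U

/-- The growth function `n ↦ dim (U + U ^ 2 + ... + U ^ n)` of a subspace `U`. -/
def growth {A : Type*} [NonUnitalRing A] [Module K A] [IsScalarTower K A A]
    [SMulCommClass K A A] (U : Submodule K A) (n : ℕ) : ℕ :=
  Module.finrank K (⨆ i : Fin n, powSubspace K U i : Submodule K A)

/-- The Gelfand-Kirillov dimension: the supremum over all finite-dimensional subspaces `U` of
`limsup_{n → ∞} log (dim (U + ... + U ^ n)) / log n`. -/
def GKdim (A : Type*) [NonUnitalRing A] [Module K A] [IsScalarTower K A A]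
    [SMulCommClass K A A] : EReal :=
  ⨆ U : {U : Submodule K A // FiniteDimensional K U},
    Filter.limsup (fun n : ℕ => ((Real.log (growth K U.1 n) / Real.log n : ℝ) : EReal))
      Filter.atTop

end Algebras

/-! ### Directed graphs -/

/-- A directed graph with vertex set `V` and edge set `E`. -/
structure DirectedGraph (V E : Type*) where
  source : E → V
  range : E → V

namespace DirectedGraph

variable {V E : Type*} (G : DirectedGraph V E)

/-- The double graph: `Sum.inl e` is the real edge `e`, and `Sum.inr e` the ghost edge `e*`. -/
def double : DirectedGraph V (E ⊕ E) where
  source := Sum.elim G.source G.range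
  range := Sum.elim G.range G.source

/-- `G.IsPath u p v`: the list of edges `p` is a path from `u` to `v`; the empty list stands for
the trivial path at `u = v`. -/
def IsPath : V → List E → V → Prop
  | u, [], v => u = v
  | u, e :: p, v => G.source e = u ∧ IsPath (G.range e) p v

/-- The relation `u ≥ v`: there is a (possibly trivial) path from `u` to `v`. -/
def Reaches (u v : V) : Prop := ∃ p, G.IsPath u p v

/-- The tree `T(X)` of a set of vertices. -/
def tree (X : Set V) : Set V := {v | ∃ u ∈ X, G.Reaches u v}

/-- A cycle based at `v`: a nontrivial path from `v` to `v` whose edges have pairwise distinct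
sources. -/
def IsCycle (v : V) (c : List E) : Prop :=
  c ≠ [] ∧ G.IsPath v c v ∧ (c.map G.source).Nodup

/-- There is no cycle. -/
def Acyclic : Prop := ¬ ∃ v c, G.IsCycle v c

/-- Two edges are in line if they are equal or one of them can be reached from the other. -/
def InLine (e f : E) : Prop :=
  e = f ∨ G.Reaches (G.range e) (G.source f) ∨ G.Reaches (G.range f) (G.source e)

section PathAlgebra

variable (K : Type*) [Field K]

open Classical in
/-- The defining relators of the path algebra: `v w - δ_{v w} v`, `s(e) e - e` and `e r(e) - e`. -/
inductive PathRel : FreeAssocAlg K (V ⊕ E) → Prop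
  | vertex (v w : V) :
      PathRel (FreeAssocAlg.letter K (Sum.inl v) * FreeAssocAlg.letter K (Sum.inl w) -
        if v = w then FreeAssocAlg.letter K (Sum.inl v) else 0)
  | source_mul (e : E) :
      PathRel (FreeAssocAlg.letter K (Sum.inl (G.source e)) * FreeAssocAlg.letter K (Sum.inr e) -
        FreeAssocAlg.letter K (Sum.inr e))
  | mul_range (e : E) :
      PathRel (FreeAssocAlg.letter K (Sum.inr e) * FreeAssocAlg.letter K (Sum.inl (G.range e)) -
        FreeAssocAlg.letter K (Sum.inr e))

/-- The path algebra `P_K(G)`. -/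
abbrev PathAlgebra : Type _ := AlgQuotient K {x : FreeAssocAlg K (V ⊕ E) | G.PathRel K x}

/-- The element of the path algebra given by a vertex. -/
def vertexElt (v : V) : G.PathAlgebra K :=
  AlgQuotient.mk K _ (FreeAssocAlg.letter K (Sum.inl v))

/-- The element of the path algebra given by an edge. -/
def edgeElt (e : E) : G.PathAlgebra K :=
  AlgQuotient.mk K _ (FreeAssocAlg.letter K (Sum.inr e))

end PathAlgebra

end DirectedGraph

/-! ### Weighted graphs -/

/-- A row-finite weighted graph with vertex set `V` and edge set `E`: every edge has a positive
integer as weight. -/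
structure WeightedGraph (V E : Type*) extends DirectedGraph V E where
  weight : E → ℕ
  weight_pos : ∀ e, 0 < weight e
  rowFinite : ∀ v, {e | source e = v}.Finite

namespace WeightedGraph

variable {V E : Type*} (G : WeightedGraph V E)

/-- The finite set `s⁻¹(v)` of edges emitted by `v`. -/
def outEdges (v : V) : Finset E := (G.rowFinite v).toFinset

/-- The weight of a vertex, the maximum of the weights of the edges it emits; it is `0` for a
sink. -/
def vertexWeight (v : V) : ℕ := (G.outEdges v).sup G.weight

/-- The set `E_w^1` of weighted edges. -/
def weightedEdges : Set E := {e | 1 < G.weight e}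

/-- The set `E_w^0` of weighted vertices. -/
def weightedVertices : Set V := {v | 1 < G.vertexWeight v}

/-- The set `T(r(E_w^1))`. -/
def weightedRangeTree : Set V := G.tree (G.range '' G.weightedEdges)

/-- The weighted part of the weighted graph is weakly well-behaved. -/
structure WeaklyWellBehaved : Prop where
  no_two_weighted : ∀ v ∈ G.weightedVertices, ∀ e ∈ G.weightedEdges, ∀ f ∈ G.weightedEdges,
    G.source e = v → G.source f = v → e = f
  no_two_edges : ∀ v ∈ G.weightedRangeTree, ∀ e f, G.source e = v → G.source f = v → e = f
  trees_disjoint : ∀ e ∈ G.weightedEdges, ∀ f ∈ G.weightedEdges, ¬ G.InLine e f →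
    G.tree {G.range e} ∩ G.tree {G.range f} = ∅
  no_cycle : ∀ v ∈ G.weightedRangeTree, ¬ ∃ c, G.IsCycle v c

/-- A forbidden closed zigzag: `n + 1` pairs of paths `p i` (from `a i` to `b i`) and `q i`
(from `a (i + 1)` to `b i`, where `i + 1` is taken modulo `n + 1`), such that `p i` starts with a
weighted edge, `q i` starts with an unweighted edge, and the last edges of `p i` and `q i` are
distinct. -/
def HasZigzag : Prop :=
  ∃ (n : ℕ) (a b : Fin (n + 1) → V) (p q : Fin (n + 1) → List E), ∀ i,
    G.IsPath (a i) (p i) (b i) ∧ G.IsPath (a (i + 1)) (q i) (b i) ∧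
    (∃ e ∈ G.weightedEdges, (p i).head? = some e) ∧
    (∃ f, f ∉ G.weightedEdges ∧ (q i).head? = some f) ∧
    (p i).getLast? ≠ (q i).getLast?

/-- The weighted part of the weighted graph is well-behaved. -/
structure WellBehaved : Prop extends G.WeaklyWellBehaved where
  no_zigzag : ¬ G.HasZigzag

/-- The directed graph associated to a weighted graph. The edge `⟨e, i⟩` stands for `e_{i+1}`:
indices start at `0` here. -/
def hat : DirectedGraph V (Σ e : E, Fin (G.weight e)) where
  source x := G.source x.1
  range x := G.range x.1

section Algebra

variable (K : Type*) [Field K]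

/-- The path algebra of the double graph of the associated directed graph. -/
abbrev DPathAlgebra : Type _ := G.hat.double.PathAlgebra K

/-- The vertex `v` in the path algebra. -/
def vert (v : V) : G.DPathAlgebra K := G.hat.double.vertexElt K v

/-- The real edge `e_{i+1}` in the path algebra, set to zero if `i + 1 > w(e)`. -/
def real (e : E) (i : ℕ) : G.DPathAlgebra K :=
  if h : i < G.weight e then G.hat.double.edgeElt K (Sum.inl ⟨e, ⟨i, h⟩⟩) else 0

/-- The ghost edge `e_{i+1}*` in the path algebra, set to zero if `i + 1 > w(e)`. -/
def ghost (e : E) (i : ℕ) : G.DPathAlgebra K :=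
  if h : i < G.weight e then G.hat.double.edgeElt K (Sum.inr ⟨e, ⟨i, h⟩⟩) else 0

open Classical in
/-- The defining relators of the weighted Leavitt path algebra:
`∑_{e ∈ s⁻¹(v)} e_i e_j* - δ_{ij} v` and `∑_{1 ≤ i ≤ w(v)} e_i* f_i - δ_{ef} r(e)`. -/
inductive LeavittRel : G.DPathAlgebra K → Prop
  | real_ghost (v : V) (i j : ℕ) (hi : i < G.vertexWeight v) (hj : j < G.vertexWeight v) :
      LeavittRel ((∑ e ∈ G.outEdges v, G.real K e i * G.ghost K e j) -
        if i = j then G.vert K v else 0)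
  | ghost_real (v : V) (e f : E) (he : e ∈ G.outEdges v) (hf : f ∈ G.outEdges v) :
      LeavittRel ((∑ i ∈ Finset.range (G.vertexWeight v), G.ghost K e i * G.real K f i) -
        if e = f then G.vert K (G.range e) else 0)

/-- The weighted Leavitt path algebra `L_K(E, w)`. -/
abbrev LeavittPathAlgebra : Type _ := AlgQuotient K {x : G.DPathAlgebra K | G.LeavittRel K x}

end Algebra

end WeightedGraph

end

/-!
The algebra `L = L_K(E, w)` has an explicit basis of words, and the theorem describes when this
basis is finite.

**The basis.** Choose at every vertex that is not a sink a special edge of maximal weight. The two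
families of defining relations, solved for `e_i e_j*` with `e` special and for `e_1* f_1`, rewrite
these forbidden pairs of letters. Words without forbidden pairs, the normal words, span `L`
(`normalSpan_eq_top`): if a letter is put in front of a normal word, one rewriting step
already gives a combination of normal words. They are linearly independent
(`linearIndependent_lpaWord`), because the same rewriting rule defines an action of `L` on the
vector space of normal words; the content is the verification of the relations in
`sum_realOp_mul_ghostOp` and `sum_ghostOp_mul_realOp`.

**Closed walks.** Normal words are walks in the graph whose vertices are the letters `e_i`, `e_i*`,
and whose edges are the allowed transitions. For a finite graph there are two cases.
If there is no closed walk, normal words do not repeat letters, so there are finitely many and `L`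
is finite-dimensional (`finiteDimensional_of_no_closed_walk`). If there is a closed walk, the powers
of the word along it are linearly independent, so that the growth is at least linear and the
Gelfand-Kirillov dimension is at least `1` (`one_le_GKdim_of_closed_walk`).

**Combinatorics.** It remains to see that closed walks are absent exactly if the graph is acyclic
and its weighted part is well-behaved. Each failure yields a closed walk
(`acyclic_of_no_closed_walk`, `wellBehaved_of_no_closed_walk`): a weighted edge admits the turn
from `e_2*` to `e_2`, so one can walk from it to an edge that is not special, or to a meeting
point of two paths with distinct last edges, and back. Conversely, a closed walk in an acyclic
graph alternates between paths `p_i` of real letters and reversed paths `q_i*` of ghost letters.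
At a turn from ghost to real letters one of the two edges is weighted, because not both indices
are `1`; at a turn from real to ghost letters, the conditions (1) to (4) imply that `p_i` and `q_i`
do not both start with weighted edges and, if one of them does, that their last edges are
distinct. Hence either all `p_i` or all `q_i` start with weighted edges, and the walk is a
closed zigzag, which condition (5) excludes (`no_closed_walk_of_wellBehaved`).
-/

noncomputable section

/-! ### Paths in directed graphs -/

theorem List.exists_eq_append_of_not_nodup_map {α β : Type*} (φ : α → β) {l : List α}
    (h : ¬ (l.map φ).Nodup) :
    ∃ l₁ a l₂ b l₃, l = l₁ ++ a :: (l₂ ++ b :: l₃) ∧ φ a = φ b := by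
  induction l with
  | nil => simp at h
  | cons a l ih =>
    by_cases ha : φ a ∈ l.map φ
    · obtain ⟨b, hb, hab⟩ := List.mem_map.1 ha
      obtain ⟨l₂, l₃, rfl⟩ := List.append_of_mem hb
      exact ⟨[], a, l₂, b, l₃, rfl, hab.symm⟩
    · obtain ⟨l₁, x, l₂, b, l₃, rfl, hx⟩ := ih fun h' => h (List.nodup_cons.2 ⟨ha, h'⟩)
      exact ⟨a :: l₁, x, l₂, b, l₃, rfl, hx⟩

namespace DirectedGraph

variable {V E : Type*} {G : DirectedGraph V E}

theorem isPath_append {u v : V} {p q : List E} :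
    G.IsPath u (p ++ q) v ↔ ∃ x, G.IsPath u p x ∧ G.IsPath x q v := by
  induction p generalizing u with
  | nil => simp [IsPath]
  | cons e p ih =>
    simp only [List.cons_append, IsPath, ih]
    constructor
    · rintro ⟨h, x, h1, h2⟩
      exact ⟨x, ⟨h, h1⟩, h2⟩
    · rintro ⟨x, ⟨h, h1⟩, h2⟩
      exact ⟨h, x, h1, h2⟩

theorem IsPath.append {u x v : V} {p q : List E} (hp : G.IsPath u p x) (hq : G.IsPath x q v) :
    G.IsPath u (p ++ q) v :=
  isPath_append.2 ⟨x, hp, hq⟩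

theorem Reaches.trans {u v x : V} (h : G.Reaches u v) (h' : G.Reaches v x) : G.Reaches u x := by
  obtain ⟨p, hp⟩ := h
  obtain ⟨q, hq⟩ := h'
  exact ⟨p ++ q, hp.append hq⟩

/-- A shortest nontrivial closed path is a cycle, so an acyclic graph has no nontrivial closed
path. -/
theorem Acyclic.eq_nil_of_isPath (hG : G.Acyclic) {v : V} {c : List E} (h : G.IsPath v c v) :
    c = [] := by
  induction hn : c.length using Nat.strong_induction_on generalizing v c with
  | _ n ih =>
    by_contra hc
    by_cases hd : (c.map G.source).Nodup
    · exact hG ⟨v, c, hc, h, hd⟩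
    · obtain ⟨l₁, e, l₂, f, l₃, rfl, hef⟩ := List.exists_eq_append_of_not_nodup_map _ hd
      obtain ⟨x, -, hx⟩ := isPath_append.1 h
      obtain ⟨y, hy, hy'⟩ := isPath_append.1 (show G.IsPath x ((e :: l₂) ++ f :: l₃) v from hx)
      have h1 : G.IsPath x (e :: l₂) x := by
        have : y = x := by rw [← hy'.1, ← hef, hx.1]
        rwa [this] at hy
      refine absurd (ih (e :: l₂).length ?_ h1 rfl) (List.cons_ne_nil _ _)
      simp only [← hn, List.length_append, List.length_cons]
      lia

/-- Paths between two given vertices are unique in an acyclic graph if every vertex reachable from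
the start emits at most one edge. -/
theorem Acyclic.isPath_unique (hG : G.Acyclic) {u v : V}
    (hu : ∀ x, G.Reaches u x → ∀ e f, G.source e = x → G.source f = x → e = f)
    {p q : List E} (hp : G.IsPath u p v) (hq : G.IsPath u q v) : p = q := by
  induction p generalizing u q with
  | nil =>
    obtain rfl : u = v := hp
    exact (hG.eq_nil_of_isPath hq).symm
  | cons e p ih =>
    cases q with
    | nil =>
      obtain rfl : u = v := hq
      exact hG.eq_nil_of_isPath hp
    | cons f q =>
      obtain rfl := hu u ⟨[], rfl⟩ e f hp.1 hq.1
      rw [ih (fun x hx => hu x ?_) hp.2 hq.2]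
      exact Reaches.trans ⟨[e], hp.1, rfl⟩ hx

end DirectedGraph

namespace WeightedGraph

variable {V E : Type*} (G : WeightedGraph V E)

/-! ### Letters and admissible transitions -/

/-- A choice, for every edge `e`, of an edge `S e` of maximal weight among the edges with the same
source as `e`. The choice depends only on the source, so every vertex that is not a sink emits
exactly one edge `e` with `S e = e`. These are the special edges. -/
structure IsSpecialChoice (S : E → E) : Prop where
  source_eq : ∀ e, G.source (S e) = G.source e
  weight_eq : ∀ e, G.weight (S e) = G.vertexWeight (G.source e)
  congr : ∀ e f, G.source e = G.source f → S e = S f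

theorem mem_outEdges {v : V} {e : E} : e ∈ G.outEdges v ↔ G.source e = v := by
  simp [outEdges]

theorem weight_le_vertexWeight (e : E) : G.weight e ≤ G.vertexWeight (G.source e) :=
  Finset.le_sup (f := G.weight) (G.mem_outEdges.2 rfl)

theorem exists_isSpecialChoice : ∃ S : E → E, G.IsSpecialChoice S := by
  have h (v : V) (hv : (G.outEdges v).Nonempty) :
      ∃ e, G.source e = v ∧ G.weight e = G.vertexWeight v := by
    obtain ⟨e, he, h⟩ := Finset.exists_mem_eq_sup _ hv G.weight
    exact ⟨e, G.mem_outEdges.1 he, h.symm⟩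
  choose s hs hw using h
  have hne (e : E) : (G.outEdges (G.source e)).Nonempty := ⟨e, G.mem_outEdges.2 rfl⟩
  refine ⟨fun e => s (G.source e) (hne e), fun e => hs _ _, fun e => hw _ _, fun e f hef => ?_⟩
  simp only [hef]

variable {G} in
theorem IsSpecialChoice.apply_self {S : E → E} (hS : G.IsSpecialChoice S) (e : E) :
    S (S e) = S e :=
  hS.congr _ _ (hS.source_eq e)

/-- The letters `e_{i+1}` (`Letter.rl e i`) and `e_{i+1}*` (`Letter.gh e i`). The index is not
bounded by the weight of the edge; `WeightedGraph.Valid` singles out the letters that occur in the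
algebra. -/
inductive Letter (E : Type*)
  | rl (e : E) (i : ℕ)
  | gh (e : E) (i : ℕ)

open Letter

/-- The vertex at which a letter starts. -/
def lsrc : Letter E → V
  | rl e _ => G.source e
  | gh e _ => G.range e

/-- The vertex at which a letter ends. -/
def ltgt : Letter E → V
  | rl e _ => G.range e
  | gh e _ => G.source e

/-- The index of the letter does not exceed the weight of the edge. -/
def Valid : Letter E → Prop
  | rl e i => i < G.weight e
  | gh e i => i < G.weight e

/-- The pairs of letters `e_i e_j*` with `e` special, and `e_1* f_1` with `s(e) = s(f)`. The
defining relations of the algebra rewrite them as combinations of vertices and of words that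
are not of this form. -/
def Forb (S : E → E) : Letter E → Letter E → Prop
  | rl e _, gh f _ => e = f ∧ S e = e
  | gh e i, rl f j => i = 0 ∧ j = 0 ∧ G.source e = G.source f
  | _, _ => False

/-- `x` and `y` may be consecutive letters of a normal word. -/
def Allowed (S : E → E) (x y : Letter E) : Prop :=
  G.Valid x ∧ G.Valid y ∧ G.ltgt x = G.lsrc y ∧ ¬ G.Forb S x y

variable {G} {S : E → E}

/-- The involution that exchanges `e_i` and `e_i*`. -/
def Letter.star : Letter E → Letter E
  | rl e i => gh e i
  | gh e i => rl e i

theorem Allowed.star {x y : Letter E} (h : G.Allowed S x y) : G.Allowed S y.star x.star := by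
  obtain ⟨hx, hy, hxy, hf⟩ := h
  cases x <;> cases y <;> refine ⟨hy, hx, hxy.symm, fun hf' => hf ?_⟩
  all_goals simp only [Forb, Letter.star] at hf' ⊢
  · exact ⟨hf'.1.symm, hf'.1 ▸ hf'.2⟩
  · exact ⟨hf'.2.1, hf'.1, hf'.2.2.symm⟩

theorem transGen_star {x y : Letter E} (h : Relation.TransGen (G.Allowed S) x y) :
    Relation.TransGen (G.Allowed S) y.star x.star := by
  rw [← Relation.transGen_swap]
  exact h.lift Letter.star fun a b hab => hab.star

theorem reflTransGen_star {x y : Letter E} (h : Relation.ReflTransGen (G.Allowed S) x y) :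
    Relation.ReflTransGen (G.Allowed S) y.star x.star := by
  rw [← Relation.reflTransGen_swap]
  exact h.lift Letter.star fun a b hab => hab.star

theorem allowed_real_real {e f : E} {i j : ℕ} (hi : i < G.weight e) (hj : j < G.weight f)
    (h : G.range e = G.source f) : G.Allowed S (rl e i) (rl f j) :=
  ⟨hi, hj, h, id⟩

theorem allowed_real_ghost {e f : E} {i j : ℕ} (hi : i < G.weight e) (hj : j < G.weight f)
    (h : G.range e = G.range f) (hef : ¬ (e = f ∧ S e = e)) :
    G.Allowed S (rl e i) (gh f j) :=
  ⟨hi, hj, h, hef⟩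

theorem allowed_ghost_real {e f : E} {i j : ℕ} (hi : i < G.weight e) (hj : j < G.weight f)
    (h : G.source e = G.source f) (hij : ¬ (i = 0 ∧ j = 0)) :
    G.Allowed S (gh e i) (rl f j) :=
  ⟨hi, hj, h, fun hf => hij ⟨hf.1, hf.2.1⟩⟩

/-! ### Closed walks from a failure of well-behavedness -/

/-- A path lifts to a walk through real letters whose first index may be prescribed. -/
theorem exists_walk_of_isPath {e : E} {p : List E} {v : V} {i : ℕ} (hi : i < G.weight e)
    (h : G.IsPath (G.range e) p v) :
    ∃ g k, (e :: p).getLast? = some g ∧ k < G.weight g ∧ G.range g = v ∧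
      Relation.ReflTransGen (G.Allowed S) (rl e i) (rl g k) := by
  induction p generalizing e i with
  | nil => exact ⟨e, i, rfl, hi, h, .refl⟩
  | cons f p ih =>
    obtain ⟨g, k, hg, hk, hv, hw⟩ := ih (G.weight_pos f) h.2
    refine ⟨g, k, ?_, hk, hv, .head (allowed_real_real hi (G.weight_pos f) h.1.symm) hw⟩
    rw [List.getLast?_cons_cons, hg]

/-- Two paths with a common endpoint give a walk that follows the first path and returns along
the second one, unless they have the same last edge and this edge is special. -/
theorem transGen_real_ghost {e f : E} {p q : List E} {v : V} {i j : ℕ} (hi : i < G.weight e)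
    (hj : j < G.weight f) (hp : G.IsPath (G.range e) p v) (hq : G.IsPath (G.range f) q v)
    (h : ∀ g, (e :: p).getLast? = some g → (f :: q).getLast? = some g → S g ≠ g) :
    Relation.TransGen (G.Allowed S) (rl e i) (gh f j) := by
  obtain ⟨g, k, hg, hk, hv, hw⟩ := exists_walk_of_isPath (S := S) hi hp
  obtain ⟨g', k', hg', hk', hv', hw'⟩ := exists_walk_of_isPath (S := S) hj hq
  refine (Relation.TransGen.single (allowed_real_ghost hk hk' (hv.trans hv'.symm) ?_)).trans_right
    hw |>.trans_left (reflTransGen_star hw')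
  rintro ⟨rfl, hs⟩
  exact h g hg hg' hs

/-- If two edges are not in line but the trees of their ranges meet, then there are paths starting
with these edges that have a common endpoint and different last edges. -/
theorem exists_paths_of_not_inLine {e f : E} (h : ¬ G.InLine e f) {v : V} {p q : List E}
    (hp : G.IsPath (G.range e) p v) (hq : G.IsPath (G.range f) q v) :
    ∃ p' q' v', G.IsPath (G.range e) p' v' ∧ G.IsPath (G.range f) q' v' ∧
      (e :: p').getLast? ≠ (f :: q').getLast? := by
  induction p using List.reverseRecOn generalizing q v with
  | nil =>
    refine ⟨[], q, v, hp, hq, fun hl => ?_⟩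
    obtain rfl | ⟨q, g, rfl⟩ := q.eq_nil_or_concat'
    · exact h (.inl (by simpa using hl))
    · obtain rfl : e = g := by
        rw [← List.cons_append, List.getLast?_concat] at hl
        simpa using hl
      obtain ⟨x, hx, hx'⟩ := DirectedGraph.isPath_append.1 hq
      exact h (.inr (.inr ⟨q, by rwa [hx'.1]⟩))
  | append_singleton p g ih =>
    obtain ⟨x, hx, hx'⟩ := DirectedGraph.isPath_append.1 hp
    by_cases hl : (e :: (p ++ [g])).getLast? = (f :: q).getLast?
    · rw [← List.cons_append, List.getLast?_concat] at hl
      obtain rfl | ⟨q, g', rfl⟩ := q.eq_nil_or_concat'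
      · obtain rfl : g = f := by simpa using hl
        exact absurd (.inr (.inl ⟨p, by rwa [hx'.1]⟩)) h
      · rw [← List.cons_append, List.getLast?_concat] at hl
        obtain rfl : g = g' := by simpa using hl
        obtain ⟨y, hy, hy'⟩ := DirectedGraph.isPath_append.1 hq
        obtain rfl : x = y := by rw [← hx'.1, hy'.1]
        exact ih hx hy
    · exact ⟨_, q, v, hp, hq, hl⟩

section NoClosedWalk

variable (hno : ∀ x, ¬ Relation.TransGen (G.Allowed S) x x)

include hno

theorem acyclic_of_no_closed_walk : G.Acyclic := by
  rintro ⟨v, c, hc, hp, -⟩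
  cases c with
  | nil => exact hc rfl
  | cons e p =>
    obtain ⟨g, k, -, hk, hv, hw⟩ := exists_walk_of_isPath (S := S) (G.weight_pos e) hp.2
    exact hno _ (.tail' hw (allowed_real_real hk (G.weight_pos e) (hv.trans hp.1.symm)))

/-- Without closed walks, an edge of weight at least two and every edge in the tree of its range
are special: otherwise walk from the index two letter of the weighted edge to the nonspecial edge
and back. -/
theorem special_of_no_closed_walk {e g : E} {p : List E} {v : V} (he : 1 < G.weight e)
    (hp : G.IsPath (G.range e) p v) (hg : (e :: p).getLast? = some g) : S g = g := by
  by_contra hs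
  refine hno (rl e 1) ((transGen_real_ghost he he hp hp fun g' hg' _ => ?_).tail
    (allowed_ghost_real he he rfl (by simp)))
  rw [hg] at hg'
  cases hg'
  exact hs

theorem wellBehaved_of_no_closed_walk (hS : G.IsSpecialChoice S) : G.WellBehaved where
  no_two_weighted v _ e he f hf hev hfv := by
    rw [← special_of_no_closed_walk hno (g := e) he (p := []) rfl rfl,
      ← special_of_no_closed_walk hno (g := f) hf (p := []) rfl rfl]
    exact hS.congr _ _ (hev.trans hfv.symm)
  no_two_edges := by
    rintro v ⟨_, ⟨x, hx, rfl⟩, p, hp⟩ e f rfl hf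
    have hsp (g : E) (hg : G.source g = G.source e) : S g = g := by
      refine special_of_no_closed_walk hno hx (p := p ++ [g]) (hp.append ⟨hg, rfl⟩) ?_
      rw [← List.cons_append, List.getLast?_concat]
    rw [← hsp e rfl, ← hsp f hf]
    exact hS.congr _ _ hf.symm
  trees_disjoint e he f hf hef := by
    rw [Set.eq_empty_iff_forall_notMem]
    rintro v ⟨⟨_, rfl, p, hp⟩, ⟨_, rfl, q, hq⟩⟩
    obtain ⟨p, q, v, hp, hq, hl⟩ := exists_paths_of_not_inLine hef hp hq
    refine hno (rl e 1) ((transGen_real_ghost he hf hp hq ?_).tail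
      (allowed_ghost_real hf hf rfl (by simp)) |>.trans <|
        (transGen_real_ghost (j := 1) hf he hq hp ?_).tail (allowed_ghost_real he he rfl (by simp)))
    · exact fun g hg hg' => absurd (hg.trans hg'.symm) hl
    · exact fun g hg hg' => absurd (hg'.trans hg.symm) hl
  no_cycle v _ := fun ⟨c, hc⟩ => acyclic_of_no_closed_walk hno ⟨v, c, hc⟩
  no_zigzag := by
    rintro ⟨n, a, b, p, q, h⟩
    choose hp hq e f hl using h
    choose e he hep using e
    choose f hf hfq using f
    have hstep (i : Fin (n + 1)) :
        Relation.TransGen (G.Allowed S) (rl (e i) 1) (rl (e (i + 1)) 1) := by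
      have h1 := hp i
      have h2 := hq i
      have h3 := hl i
      have h4 : G.source (e (i + 1)) = a (i + 1) := by
        obtain ⟨l, hl⟩ := List.head?_eq_some_iff.1 (hep (i + 1))
        have := hp (i + 1)
        rw [hl] at this
        exact this.1
      obtain ⟨l, hel⟩ := List.head?_eq_some_iff.1 (hep i)
      obtain ⟨l', hfl⟩ := List.head?_eq_some_iff.1 (hfq i)
      rw [hel] at h1 h3
      rw [hfl] at h2 h3
      refine (transGen_real_ghost (he i) (G.weight_pos (f i)) h1.2 h2.2 fun g hg hg' => ?_).tail
        (allowed_ghost_real (G.weight_pos (f i)) (he (i + 1)) (h2.1.trans h4.symm) (by simp))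
      exact absurd (hg.trans hg'.symm) h3
    have hall (k : ℕ) : Relation.TransGen (G.Allowed S) (rl (e 0) 1)
        (rl (e (Fin.ofNat (n + 1) k + 1)) 1) := by
      induction k with
      | zero => exact hstep 0
      | succ k ih =>
        have : Fin.ofNat (n + 1) (k + 1) = Fin.ofNat (n + 1) k + 1 := by
          ext
          simp [Fin.val_add]
        rw [this]
        exact ih.trans (hstep _)
    have h0 : Fin.ofNat (n + 1) n + 1 = 0 := by
      ext
      simp
    have := hall n
    rw [h0] at this
    exact hno _ this

end NoClosedWalk

end WeightedGraph

namespace WeightedGraph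

variable {V E : Type*} {G : WeightedGraph V E} {S : E → E}

open Letter

/-! ### Well-behaved acyclic weighted graphs have no closed walks -/

variable (G) in
/-- One pair of paths `p`, `q` of a zigzag, from `a` to a common endpoint and from `a'` to it. -/
def ZigzagStep (a a' : V) : Prop :=
  ∃ b p q, G.IsPath a p b ∧ G.IsPath a' q b ∧ (∃ e ∈ G.weightedEdges, p.head? = some e) ∧
    (∃ f, f ∉ G.weightedEdges ∧ q.head? = some f) ∧ p.getLast? ≠ q.getLast?

theorem exists_seq_of_transGen {α : Type*} {r : α → α → Prop} {a b : α}
    (h : Relation.TransGen r a b) :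
    ∃ (n : ℕ) (f : ℕ → α), f 0 = a ∧ f (n + 1) = b ∧ ∀ i ≤ n, r (f i) (f (i + 1)) := by
  induction h with
  | @single b h =>
    refine ⟨0, fun i => if i = 0 then a else b, rfl, rfl, fun i hi => ?_⟩
    obtain rfl : i = 0 := by lia
    exact h
  | @tail b c _ h ih =>
    obtain ⟨n, f, h0, hn, hf⟩ := ih
    refine ⟨n + 1, fun i => if i ≤ n + 1 then f i else c, by simpa using h0, by simp, ?_⟩
    intro i hi
    rcases hi.lt_or_eq with hi | rfl
    · have h1 : i ≤ n + 1 := hi.le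
      have h2 : i + 1 ≤ n + 1 := hi
      simp only [h1, h2, if_true]
      exact hf i (by lia)
    · simpa [hn] using h

theorem hasZigzag_of_transGen {a : V} (h : Relation.TransGen G.ZigzagStep a a) :
    G.HasZigzag := by
  obtain ⟨n, f, h0, hn, hf⟩ := exists_seq_of_transGen h
  have hf' (i : Fin (n + 1)) : G.ZigzagStep (f i) (f (i + 1 : Fin (n + 1))) := by
    have := hf i (by lia)
    rcases eq_or_ne i (Fin.last n) with rfl | hi
    · rw [Fin.last_add_one, Fin.val_zero, h0, ← hn]
      exact this
    · rwa [Fin.val_add_one_of_lt (Fin.lt_last_iff_ne_last.2 hi)]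
  choose b p q h using hf'
  exact ⟨n, fun i => f i, b, p, q, h⟩

section WellBehaved

variable (hG : G.Acyclic) (hW : G.WellBehaved) (hS : G.IsSpecialChoice S)

include hG hW

/-- Paths that start with weighted edges and have a common endpoint have the same last edge: by
condition (3) one of the paths is the final part of the other, because below a weighted edge paths
between two given vertices are unique. -/
theorem getLast?_eq_of_weighted {e f : E} (he : e ∈ G.weightedEdges) (hf : f ∈ G.weightedEdges)
    {p q : List E} {v : V} (hp : G.IsPath (G.range e) p v) (hq : G.IsPath (G.range f) q v) :
    (e :: p).getLast? = (f :: q).getLast? := by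
  have huniq {e : E} (he : e ∈ G.weightedEdges) {p q : List E}
      (hp : G.IsPath (G.range e) p v) (hq : G.IsPath (G.range e) q v) : p = q :=
    hG.isPath_unique (fun x hx => hW.no_two_edges x ⟨_, ⟨e, he, rfl⟩, hx⟩) hp hq
  have hline {e f : E} (he : e ∈ G.weightedEdges) {p q : List E} (hp : G.IsPath (G.range e) p v)
      (hq : G.IsPath (G.range f) q v) (h : G.Reaches (G.range e) (G.source f)) :
      (e :: p).getLast? = (f :: q).getLast? := by
    obtain ⟨t, ht⟩ := h
    obtain rfl := huniq he hp (ht.append (q := f :: q) ⟨rfl, hq⟩)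
    rw [← List.cons_append, List.getLast?_append_of_ne_nil _ (List.cons_ne_nil _ _)]
  by_cases h : G.InLine e f
  · rcases h with rfl | h | h
    · rw [huniq he hp hq]
    · exact hline he hp hq h
    · exact (hline hf hq hp h).symm
  · have := hW.trees_disjoint e he f hf h
    exact absurd this (Set.Nonempty.ne_empty ⟨v, ⟨_, rfl, p, hp⟩, ⟨_, rfl, q, hq⟩⟩)

omit hG in
include hS in
theorem special_of_weighted {e : E} (he : e ∈ G.weightedEdges) : S e = e := by
  have h : 1 < G.vertexWeight (G.source e) := lt_of_lt_of_le he (G.weight_le_vertexWeight e)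
  refine hW.no_two_weighted (G.source e) h _ ?_ e he (hS.source_eq e) rfl
  change 1 < G.weight (S e)
  rwa [hS.weight_eq]

omit hG in
include hS in
theorem special_of_isPath_of_weighted {e g : E} (he : e ∈ G.weightedEdges) {p : List E} {v : V}
    (hp : G.IsPath (G.range e) p v) (hg : (e :: p).getLast? = some g) : S g = g := by
  obtain rfl | ⟨p, g', rfl⟩ := p.eq_nil_or_concat'
  · obtain rfl : e = g := by simpa using hg
    exact special_of_weighted hW hS he
  · obtain rfl : g' = g := by
      rw [← List.cons_append, List.getLast?_concat] at hg
      simpa using hg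
    obtain ⟨x, hx, hx'⟩ := DirectedGraph.isPath_append.1 hp
    exact hW.no_two_edges x ⟨_, ⟨e, he, rfl⟩, p, hx⟩ _ _ ((hS.source_eq g').trans hx'.1) hx'.1

/-- What is known about the last letter of a walk whose first letter is real, starts at `a₀` and
belongs to a weighted edge: the walk has completed some zigzag steps, and the step in progress
consists of a path `e :: p` with `e` weighted and, if the last letter is a ghost letter, of a path
`g :: q` that has been followed backwards. -/
def WalkInvariant (G : WeightedGraph V E) (a₀ : V) : Letter E → Prop
  | rl g _ => ∃ e ∈ G.weightedEdges, ∃ p, Relation.ReflTransGen G.ZigzagStep a₀ (G.source e) ∧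
      G.IsPath (G.range e) p (G.range g) ∧ (e :: p).getLast? = some g
  | gh g _ => ∃ e ∈ G.weightedEdges, ∃ p q b,
      Relation.ReflTransGen G.ZigzagStep a₀ (G.source e) ∧
      G.IsPath (G.range e) p b ∧ G.IsPath (G.range g) q b ∧
      (e :: p).getLast? ≠ (g :: q).getLast?

/-- At a transition from a ghost to a real letter the zigzag step in progress is complete: the
ghost letter is unweighted, hence has index `0`, so that the real letter must be weighted. -/
theorem WalkInvariant.zigzagStep {a₀ : V} {g h : E} {i j : ℕ}
    (hg : WalkInvariant G a₀ (gh g i)) (hgh : G.Allowed S (gh g i) (rl h j)) :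
    Relation.TransGen G.ZigzagStep a₀ (G.source h) ∧ h ∈ G.weightedEdges := by
  obtain ⟨e, he, p, q, b, ha, hp, hq, hl⟩ := hg
  obtain ⟨hi, hj, hs, hf⟩ := hgh
  have hgw : g ∉ G.weightedEdges := fun hgw => hl (getLast?_eq_of_weighted hG hW he hgw hp hq)
  refine ⟨Relation.TransGen.tail' ha ⟨b, e :: p, g :: q, ⟨rfl, hp⟩, ⟨hs, hq⟩, ⟨e, he, rfl⟩,
    ⟨g, hgw, rfl⟩, hl⟩, ?_⟩
  have h1 : ¬ 1 < G.weight g := hgw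
  simp only [Valid, Forb, ltgt, lsrc] at hi hj hf hs
  by_contra h2
  have h3 : ¬ 1 < G.weight h := h2
  exact hf ⟨by lia, by lia, hs⟩

include hS in
theorem WalkInvariant.step {a₀ : V} {x y : Letter E} (hx : WalkInvariant G a₀ x)
    (hxy : G.Allowed S x y) : WalkInvariant G a₀ y := by
  match x, y with
  | rl g i, rl h j =>
    obtain ⟨e, he, p, ha, hp, hl⟩ := hx
    refine ⟨e, he, p ++ [h], ha, hp.append ⟨hxy.2.2.1.symm, rfl⟩, ?_⟩
    rw [← List.cons_append, List.getLast?_concat]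
  | rl g i, gh h j =>
    obtain ⟨e, he, p, ha, hp, hl⟩ := hx
    obtain ⟨-, -, hs, hf⟩ := hxy
    refine ⟨e, he, p, [], _, ha, hp, hs.symm, fun hl' => hf ?_⟩
    rw [hl] at hl'
    obtain rfl : g = h := by simpa using hl'
    exact ⟨rfl, special_of_isPath_of_weighted hW hS he hp hl⟩
  | gh g i, gh h j =>
    obtain ⟨e, he, p, q, b, ha, hp, hq, hl⟩ := hx
    refine ⟨e, he, p, g :: q, b, ha, hp, ⟨hxy.2.2.1, hq⟩, ?_⟩
    rwa [List.getLast?_cons_cons]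
  | gh g i, rl h j =>
    obtain ⟨ha, hh⟩ := hx.zigzagStep hG hW hxy
    exact ⟨h, hh, [], ha.to_reflTransGen, rfl, rfl⟩

include hS in
/-- There is no closed walk with a transition from a ghost letter to a weighted real letter: it
would give a closed zigzag. -/
theorem false_of_closed_walk_of_weighted {g h : E} {i j : ℕ}
    (hgh : G.Allowed S (gh g i) (rl h j)) (hh : h ∈ G.weightedEdges)
    (hw : Relation.ReflTransGen (G.Allowed S) (rl h j) (gh g i)) : False := by
  have h0 : WalkInvariant G (G.source h) (rl h j) := ⟨h, hh, [], .refl, rfl, rfl⟩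
  have hall {x : Letter E} (hx : Relation.ReflTransGen (G.Allowed S) (rl h j) x) :
      WalkInvariant G (G.source h) x := by
    induction hx with
    | refl => exact h0
    | tail _ hxy ih => exact ih.step hG hW hS hxy
  exact hW.no_zigzag (hasZigzag_of_transGen ((hall hw).zigzagStep hG hW hgh).1)

include hS in
theorem false_of_closed_walk_of_ghost_real {g h : E} {i j : ℕ}
    (hgh : G.Allowed S (gh g i) (rl h j))
    (hw : Relation.ReflTransGen (G.Allowed S) (rl h j) (gh g i)) : False := by
  by_cases hh : h ∈ G.weightedEdges
  · exact false_of_closed_walk_of_weighted hG hW hS hgh hh hw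
  · -- Now `g` is weighted, and the walk is reversed by the involution.
    by_cases hg : g ∈ G.weightedEdges
    · exact false_of_closed_walk_of_weighted hG hW hS hgh.star hg (reflTransGen_star hw)
    · obtain ⟨hi, hj, hs, hf⟩ := hgh
      have h1 : ¬ 1 < G.weight g := hg
      have h2 : ¬ 1 < G.weight h := hh
      simp only [Valid, Forb, ltgt, lsrc] at hi hj hf hs
      exact hf ⟨by lia, by lia, hs⟩

include hS in
theorem no_closed_walk_of_wellBehaved (x : Letter E) :
    ¬ Relation.TransGen (G.Allowed S) x x := by
  -- By the involution the first letter may be assumed real. By acyclicity the walk leaves the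
  -- real letters, and when it returns to them it passes from a ghost to a real letter.
  wlog hx : ∃ e i, x = rl e i generalizing x
  · intro h
    obtain ⟨e, i⟩ | ⟨e, i⟩ := x
    · exact hx ⟨e, i, rfl⟩
    · exact this _ ⟨e, i, rfl⟩ (transGen_star h)
  obtain ⟨e, i, rfl⟩ := hx
  intro h
  have key {z : Letter E} (hz : Relation.TransGen (G.Allowed S) (rl e i) z) :
      (∃ f j, z = rl f j ∧ ∃ p, p ≠ [] ∧ G.IsPath (G.range e) p (G.range f)) ∨
      (∃ f j, z = gh f j) ∨
      ∃ g k h l, G.Allowed S (gh g k) (rl h l) ∧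
        Relation.ReflTransGen (G.Allowed S) (rl e i) (gh g k) ∧
        Relation.ReflTransGen (G.Allowed S) (rl h l) z := by
    induction hz with
    | @single z hz =>
      match z, hz with
      | rl f j, hz => exact .inl ⟨f, j, rfl, [f], List.cons_ne_nil _ _, hz.2.2.1.symm, rfl⟩
      | gh f j, _ => exact .inr (.inl ⟨f, j, rfl⟩)
    | @tail y z hy hyz ih =>
      rcases ih with ⟨f, j, rfl, p, hp, hpath⟩ | ⟨f, j, rfl⟩ | ⟨g, k, h, l, h1, h2, h3⟩
      · match z, hyz with
        | rl f' j', hz =>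
          exact .inl ⟨f', j', rfl, p ++ [f'], by simp, hpath.append ⟨hz.2.2.1.symm, rfl⟩⟩
        | gh f' j', _ => exact .inr (.inl ⟨f', j', rfl⟩)
      · match z, hyz with
        | rl f' j', hz =>
          exact .inr (.inr ⟨f, j, f', j', hz, hy.to_reflTransGen, .refl⟩)
        | gh f' j', _ => exact .inr (.inl ⟨f', j', rfl⟩)
      · exact .inr (.inr ⟨g, k, h, l, h1, h2, h3.tail hyz⟩)
  rcases key h with ⟨f, j, hf, p, hp, hpath⟩ | ⟨f, j, hf⟩ | ⟨g, k, h, l, h1, h2, h3⟩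
  · cases hf
    exact hp (hG.eq_nil_of_isPath hpath)
  · cases hf
  · exact false_of_closed_walk_of_ghost_real hG hW hS h1 (h3.trans h2)

end WellBehaved

end WeightedGraph

namespace WeightedGraph

variable {V E : Type*} (G : WeightedGraph V E) (S : E → E)

open Letter

/-! ### Normal words -/

/-- The vertex at which the word `w` starts, where `w` is a list of letters that ends at `v`; the
empty list stands for the trivial word `v`. -/
def wsrc (v : V) : List (Letter E) → V
  | [] => v
  | x :: _ => G.lsrc x

/-- The list `w` of letters is a path in the double graph that ends at `v`, and no two consecutive
letters form a forbidden pair. -/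
def Normal (v : V) : List (Letter E) → Prop
  | [] => True
  | x :: w => G.Valid x ∧ G.ltgt x = G.wsrc v w ∧ (∀ y ∈ w.head?, ¬ G.Forb S x y) ∧ Normal v w

variable {G S}

theorem Normal.of_cons {v : V} {x : Letter E} {w : List (Letter E)} (h : G.Normal S v (x :: w)) :
    G.Normal S v w :=
  h.2.2.2

theorem Normal.cons_of_allowed {v : V} {x y : Letter E} {w : List (Letter E)}
    (hxy : G.Allowed S x y) (h : G.Normal S v (y :: w)) : G.Normal S v (x :: y :: w) :=
  ⟨hxy.1, hxy.2.2.1, by simpa using hxy.2.2.2, h⟩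

theorem Normal.allowed {v : V} {x y : Letter E} {w : List (Letter E)}
    (h : G.Normal S v (x :: y :: w)) : G.Allowed S x y :=
  ⟨h.1, h.of_cons.1, h.2.1, h.2.2.1 y rfl⟩

variable (K : Type*) [Field K] (G S)

/-- The vector space spanned by all pairs of a vertex and a list of letters. The algebra acts on
it, and only the normal words contribute to this action. -/
abbrev WordSpace (K V E : Type*) [Field K] : Type _ := (V × List (Letter E)) →₀ K

open Classical in
/-- The basis vector of a normal word, and zero for all other words. -/
def nf (v : V) (w : List (Letter E)) : WordSpace K V E :=
  if G.Normal S v w then Finsupp.single (v, w) 1 else 0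

open Classical in
/-- The linear map that is given by `φ` on normal words and is zero on the other words. -/
def onNormal (φ : V → List (Letter E) → WordSpace K V E) : Module.End K (WordSpace K V E) :=
  Finsupp.linearCombination K fun x => if G.Normal S x.1 x.2 then φ x.1 x.2 else 0

variable {K G S}

theorem nf_of_normal {v : V} {w : List (Letter E)} (h : G.Normal S v w) :
    G.nf S K v w = Finsupp.single (v, w) 1 :=
  if_pos h

theorem nf_of_not_normal {v : V} {w : List (Letter E)} (h : ¬ G.Normal S v w) :
    G.nf S K v w = 0 :=
  if_neg h

theorem onNormal_single_of_not_normal {φ : V → List (Letter E) → WordSpace K V E} {v : V}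
    {w : List (Letter E)} (h : ¬ G.Normal S v w) :
    G.onNormal S K φ (Finsupp.single (v, w) 1) = 0 := by
  simp [onNormal, h]

theorem onNormal_nf {φ : V → List (Letter E) → WordSpace K V E} {v : V}
    {w : List (Letter E)} (h : G.Normal S v w) : G.onNormal S K φ (G.nf S K v w) = φ v w := by
  simp [onNormal, nf_of_normal h, h]

theorem end_ext {f g : Module.End K (WordSpace K V E)}
    (h : ∀ v w, G.Normal S v w → f (G.nf S K v w) = g (G.nf S K v w))
    (h' : ∀ v w, ¬ G.Normal S v w →
      f (Finsupp.single (v, w) 1) = g (Finsupp.single (v, w) 1)) : f = g := by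
  refine Finsupp.lhom_ext' fun x => LinearMap.ext_ring ?_
  obtain ⟨v, w⟩ := x
  by_cases hx : G.Normal S v w
  · simpa [nf_of_normal hx] using h v w hx
  · exact h' v w hx

/-! ### The action of the generators on normal words -/

variable (K G S)

open Classical in
/-- Left multiplication of the normal word `w` by the vertex `u`. -/
def vertVal (u v : V) (w : List (Letter E)) : WordSpace K V E :=
  if G.wsrc v w = u then G.nf S K v w else 0

open Classical in
/-- Left multiplication of the normal word `w` by `e_{i+1}`. A forbidden pair is rewritten by the
relation `∑ e_i e_j* = δ_{ij} v`, solved for the summand of the special edge. -/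
def realVal (e : E) (i : ℕ) (v : V) : List (Letter E) → WordSpace K V E
  | gh f j :: w =>
    if e = f ∧ S e = e then
      (if i = j then G.nf S K v w else 0) -
        ∑ g ∈ (G.outEdges (G.source e)).erase e, G.nf S K v (rl g i :: gh g j :: w)
    else G.nf S K v (rl e i :: gh f j :: w)
  | w => G.nf S K v (rl e i :: w)

open Classical in
/-- Left multiplication of the normal word `w` by `e_{i+1}*`. A forbidden pair is rewritten by the
relation `∑ e_i* f_i = δ_{ef} r(e)`, solved for the first summand. -/
def ghostVal (e : E) (i : ℕ) (v : V) : List (Letter E) → WordSpace K V E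
  | rl f j :: w =>
    if i = 0 ∧ j = 0 ∧ G.source e = G.source f then
      (if e = f then G.nf S K v w else 0) -
        ∑ k ∈ Finset.Ico 1 (G.vertexWeight (G.source e)), G.nf S K v (gh e k :: rl f k :: w)
    else G.nf S K v (gh e i :: rl f j :: w)
  | w => G.nf S K v (gh e i :: w)

/-- The operator by which the vertex `u` acts. -/
def vertOp (u : V) : Module.End K (WordSpace K V E) := G.onNormal S K (G.vertVal S K u)

/-- The operator by which `e_{i+1}` acts. -/
def realOp (e : E) (i : ℕ) : Module.End K (WordSpace K V E) := G.onNormal S K (G.realVal S K e i)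

/-- The operator by which `e_{i+1}*` acts. -/
def ghostOp (e : E) (i : ℕ) : Module.End K (WordSpace K V E) :=
  G.onNormal S K (G.ghostVal S K e i)

variable {K G S}

theorem vertOp_nf_of_eq {u v : V} {w : List (Letter E)} (hu : G.wsrc v w = u) :
    G.vertOp S K u (G.nf S K v w) = G.nf S K v w := by
  by_cases h : G.Normal S v w
  · rw [vertOp, onNormal_nf h, vertVal, if_pos hu]
  · rw [nf_of_not_normal h, map_zero]

theorem vertOp_nf_of_ne {u v : V} {w : List (Letter E)} (hu : G.wsrc v w ≠ u) :
    G.vertOp S K u (G.nf S K v w) = 0 := by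
  by_cases h : G.Normal S v w
  · rw [vertOp, onNormal_nf h, vertVal, if_neg hu]
  · rw [nf_of_not_normal h, map_zero]

open Classical in
theorem vertOp_nf (u v : V) (w : List (Letter E)) :
    G.vertOp S K u (G.nf S K v w) = if G.wsrc v w = u then G.nf S K v w else 0 := by
  split_ifs with h
  · exact vertOp_nf_of_eq h
  · exact vertOp_nf_of_ne h

theorem realOp_nf {e : E} {i : ℕ} {v : V} {w : List (Letter E)}
    (h : ∀ y ∈ w.head?, ¬ G.Forb S (rl e i) y) :
    G.realOp S K e i (G.nf S K v w) = G.nf S K v (rl e i :: w) := by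
  by_cases hw : G.Normal S v w
  · rw [realOp, onNormal_nf hw]
    match w, h with
    | [], _ => rfl
    | rl f j :: w, _ => rfl
    | gh f j :: w, h => exact if_neg (h _ rfl)
  · rw [nf_of_not_normal hw, nf_of_not_normal fun h' => hw h'.of_cons, map_zero]

theorem ghostOp_nf {e : E} {i : ℕ} {v : V} {w : List (Letter E)}
    (h : ∀ y ∈ w.head?, ¬ G.Forb S (gh e i) y) :
    G.ghostOp S K e i (G.nf S K v w) = G.nf S K v (gh e i :: w) := by
  by_cases hw : G.Normal S v w
  · rw [ghostOp, onNormal_nf hw]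
    match w, h with
    | [], _ => rfl
    | gh f j :: w, _ => rfl
    | rl f j :: w, h => exact if_neg (h _ rfl)
  · rw [nf_of_not_normal hw, nf_of_not_normal fun h' => hw h'.of_cons, map_zero]

open Classical in
theorem realOp_nf_gh {e : E} {i j : ℕ} {v : V} {w : List (Letter E)} (hs : S e = e)
    (hw : G.Normal S v (gh e j :: w)) :
    G.realOp S K e i (G.nf S K v (gh e j :: w)) = (if i = j then G.nf S K v w else 0) -
      ∑ g ∈ (G.outEdges (G.source e)).erase e, G.nf S K v (rl g i :: gh g j :: w) := by
  rw [realOp, onNormal_nf hw]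
  exact if_pos ⟨rfl, hs⟩

open Classical in
theorem ghostOp_nf_rl {e f : E} {v : V} {w : List (Letter E)} (hef : G.source e = G.source f)
    (hw : G.Normal S v (rl f 0 :: w)) :
    G.ghostOp S K e 0 (G.nf S K v (rl f 0 :: w)) = (if e = f then G.nf S K v w else 0) -
      ∑ k ∈ Finset.Ico 1 (G.vertexWeight (G.source e)), G.nf S K v (gh e k :: rl f k :: w) := by
  rw [ghostOp, onNormal_nf hw]
  exact if_pos ⟨rfl, rfl, hef⟩

theorem realOp_single_of_not_normal {e : E} {i : ℕ} {v : V} {w : List (Letter E)}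
    (h : ¬ G.Normal S v w) : G.realOp S K e i (Finsupp.single (v, w) 1) = 0 :=
  onNormal_single_of_not_normal h

theorem ghostOp_single_of_not_normal {e : E} {i : ℕ} {v : V} {w : List (Letter E)}
    (h : ¬ G.Normal S v w) : G.ghostOp S K e i (Finsupp.single (v, w) 1) = 0 :=
  onNormal_single_of_not_normal h

theorem vertOp_single_of_not_normal {u v : V} {w : List (Letter E)}
    (h : ¬ G.Normal S v w) : G.vertOp S K u (Finsupp.single (v, w) 1) = 0 :=
  onNormal_single_of_not_normal h

/-! ### The operators satisfy the defining relations -/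

open Classical in
theorem vertOp_mul_vertOp (u u' : V) :
    G.vertOp S K u * G.vertOp S K u' = if u = u' then G.vertOp S K u else 0 := by
  refine end_ext (G := G) (S := S) (fun v w _ => ?_) fun v w h => ?_
  · rw [Module.End.mul_apply, vertOp_nf]
    split_ifs with h h' h'
    · rw [vertOp_nf_of_eq (h.trans h'.symm)]
    · rw [vertOp_nf_of_ne fun h'' => h' (h''.symm.trans h)]
      rfl
    · rw [map_zero, vertOp_nf_of_ne fun h'' => h (h''.trans h')]
    · rw [map_zero]
      rfl
  · rw [Module.End.mul_apply, vertOp_single_of_not_normal h]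
    split_ifs <;> simp [vertOp_single_of_not_normal h]

open Classical in
theorem vertOp_source_mul_realOp (e : E) (i : ℕ) :
    G.vertOp S K (G.source e) * G.realOp S K e i = G.realOp S K e i := by
  refine end_ext (G := G) (S := S) (fun v w hw => ?_) fun v w h => ?_
  · rw [Module.End.mul_apply]
    by_cases hf : ∀ y ∈ w.head?, ¬ G.Forb S (rl e i) y
    · rw [realOp_nf hf]
      exact vertOp_nf_of_eq rfl
    · push Not at hf
      obtain ⟨y, hy, hf⟩ := hf
      match w, y, hy, hf, hw with
      | gh _ j :: w, _, rfl, ⟨rfl, hs⟩, hw =>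
        rw [realOp_nf_gh hs hw, map_sub, map_sum]
        congr 1
        · split_ifs
          · exact vertOp_nf_of_eq hw.2.1.symm
          · rw [map_zero]
        · refine Finset.sum_congr rfl fun g hg => ?_
          exact vertOp_nf_of_eq (G.mem_outEdges.1 (Finset.mem_of_mem_erase hg))
  · rw [Module.End.mul_apply, realOp_single_of_not_normal h, map_zero]

open Classical in
theorem vertOp_range_mul_ghostOp (e : E) (i : ℕ) :
    G.vertOp S K (G.range e) * G.ghostOp S K e i = G.ghostOp S K e i := by
  refine end_ext (G := G) (S := S) (fun v w hw => ?_) fun v w h => ?_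
  · rw [Module.End.mul_apply]
    by_cases hf : ∀ y ∈ w.head?, ¬ G.Forb S (gh e i) y
    · rw [ghostOp_nf hf]
      exact vertOp_nf_of_eq rfl
    · push Not at hf
      obtain ⟨y, hy, hf⟩ := hf
      match w, y, hy, hf, hw with
      | rl f _ :: w, _, rfl, ⟨hi, rfl, hs⟩, hw =>
        subst hi
        rw [ghostOp_nf_rl hs hw, map_sub, map_sum]
        congr 1
        · split_ifs with h
          · subst h
            exact vertOp_nf_of_eq hw.2.1.symm
          · rw [map_zero]
        · refine Finset.sum_congr rfl fun k _ => ?_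
          exact vertOp_nf_of_eq rfl
  · rw [Module.End.mul_apply, ghostOp_single_of_not_normal h, map_zero]

theorem realOp_mul_vertOp_range (e : E) (i : ℕ) :
    G.realOp S K e i * G.vertOp S K (G.range e) = G.realOp S K e i := by
  refine end_ext (G := G) (S := S) (fun v w hw => ?_) fun v w h => ?_
  · rw [Module.End.mul_apply, vertOp_nf]
    split_ifs with h
    · rfl
    · rw [map_zero, realOp_nf, nf_of_not_normal fun h' : G.Normal S v (rl e i :: w) =>
        h h'.2.1.symm]
      intro y hy hf
      match w, y, hy, hf with
      | gh _ j :: w, _, rfl, ⟨rfl, hs⟩ => exact h rfl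
  · rw [Module.End.mul_apply, realOp_single_of_not_normal h, vertOp_single_of_not_normal h,
      map_zero]

theorem ghostOp_mul_vertOp_source (e : E) (i : ℕ) :
    G.ghostOp S K e i * G.vertOp S K (G.source e) = G.ghostOp S K e i := by
  refine end_ext (G := G) (S := S) (fun v w hw => ?_) fun v w h => ?_
  · rw [Module.End.mul_apply, vertOp_nf]
    split_ifs with h
    · rfl
    · rw [map_zero, ghostOp_nf, nf_of_not_normal fun h' : G.Normal S v (gh e i :: w) =>
        h h'.2.1.symm]
      intro y hy hf
      match w, y, hy, hf with
      | rl f _ :: w, _, rfl, ⟨_, _, hs⟩ => exact h hs.symm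
  · rw [Module.End.mul_apply, ghostOp_single_of_not_normal h, vertOp_single_of_not_normal h,
      map_zero]

section Leavitt

variable (hS : G.IsSpecialChoice S)

include hS

theorem exists_special {u : V} (hu : 0 < G.vertexWeight u) :
    ∃ e, G.source e = u ∧ S e = e ∧ G.weight e = G.vertexWeight u := by
  obtain ⟨e, he⟩ : (G.outEdges u).Nonempty := by
    rw [Finset.nonempty_iff_ne_empty]
    intro h
    simp [vertexWeight, h] at hu
  have he := G.mem_outEdges.1 he
  exact ⟨S e, (hS.source_eq e).trans he, hS.apply_self e, by rw [hS.weight_eq, he]⟩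

open Classical in
/-- The relation `∑ e_i e_j* = δ_{ij} u` on words `w` for which no `e_j* w` needs rewriting. -/
theorem sum_realOp_ghostOp_nf_of_not_forb {u v : V} {w : List (Letter E)} {i j : ℕ}
    (hj : j < G.vertexWeight u)
    (hw : ∀ e, G.source e = u → ∀ y ∈ w.head?, ¬ G.Forb S (gh e j) y) :
    ∑ e ∈ G.outEdges u, G.realOp S K e i (G.ghostOp S K e j (G.nf S K v w)) =
      if i = j then G.vertOp S K u (G.nf S K v w) else 0 := by
  obtain ⟨e, rfl, hs, he⟩ := exists_special hS (Nat.zero_lt_of_lt hj)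
  have h1 : ∀ g ∈ (G.outEdges (G.source e)).erase e,
      G.realOp S K g i (G.ghostOp S K g j (G.nf S K v w)) =
        G.nf S K v (rl g i :: gh g j :: w) := by
    intro g hg
    obtain ⟨hne, hg⟩ := Finset.mem_erase.1 hg
    rw [G.mem_outEdges] at hg
    rw [ghostOp_nf (hw g hg), realOp_nf]
    rintro _ ⟨⟩ ⟨-, hs'⟩
    exact hne (by rw [← hs', hS.congr g e hg, hs])
  rw [← Finset.add_sum_erase _ _ (G.mem_outEdges.2 rfl), Finset.sum_congr rfl h1,
    ghostOp_nf (hw e rfl)]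
  by_cases hn : G.Normal S v (gh e j :: w)
  · rw [realOp_nf_gh hs hn, sub_add_cancel,
      vertOp_nf_of_eq (show G.wsrc v w = G.source e from hn.2.1.symm)]
  · have hn' (hwn : G.Normal S v w) : ¬ G.wsrc v w = G.source e := fun h =>
      hn ⟨hj.trans_eq he.symm, h.symm, hw e rfl, hwn⟩
    have h2 : G.vertOp S K (G.source e) (G.nf S K v w) = 0 := by
      by_cases hwn : G.Normal S v w
      · rw [vertOp_nf_of_ne (hn' hwn)]
      · rw [nf_of_not_normal hwn, map_zero]
    rw [nf_of_not_normal hn, map_zero, zero_add, h2, ite_self]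
    refine Finset.sum_eq_zero fun g hg => nf_of_not_normal fun h => ?_
    refine hn' h.of_cons.of_cons ?_
    rw [← h.of_cons.2.1]
    exact G.mem_outEdges.1 (Finset.mem_of_mem_erase hg)

open Classical in
theorem sum_realOp_mul_ghostOp {u : V} {i j : ℕ} (hi : i < G.vertexWeight u)
    (hj : j < G.vertexWeight u) :
    ∑ e ∈ G.outEdges u, G.realOp S K e i * G.ghostOp S K e j =
      if i = j then G.vertOp S K u else 0 := by
  refine end_ext (G := G) (S := S) (fun v w hw => ?_) fun v w h => ?_
  · rw [LinearMap.sum_apply]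
    simp only [Module.End.mul_apply]
    by_cases hf : ∀ e, G.source e = u → ∀ y ∈ w.head?, ¬ G.Forb S (gh e j) y
    · rw [sum_realOp_ghostOp_nf_of_not_forb hS hj hf]
      split_ifs <;> rfl
    · push Not at hf
      obtain ⟨e, rfl, y, hy, hf⟩ := hf
      match w, y, hy, hf, hw with
      | rl g _ :: w, _, rfl, ⟨hj0, rfl, hs⟩, hw =>
        subst hj0
        -- Rewriting the forbidden pairs leaves words to which the previous case applies.
        have h1 : ∀ f ∈ G.outEdges (G.source e),
            G.realOp S K f i (G.ghostOp S K f 0 (G.nf S K v (rl g 0 :: w))) =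
              (if f = g then G.realOp S K f i (G.nf S K v w) else 0) -
              ∑ k ∈ Finset.Ico 1 (G.vertexWeight (G.source e)),
                G.realOp S K f i (G.ghostOp S K f k (G.nf S K v (rl g k :: w))) := by
          intro f hf
          rw [G.mem_outEdges] at hf
          rw [ghostOp_nf_rl (hf.trans hs) hw, map_sub, map_sum, apply_ite (G.realOp S K f i),
            map_zero, hf]
          congr 1
          refine Finset.sum_congr rfl fun k hk => ?_
          rw [ghostOp_nf (by
            rintro _ ⟨⟩ ⟨hk', -⟩
            exact absurd (Finset.mem_Ico.1 hk).1 (by simp [hk']))]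
        have h2 : ∀ k ∈ Finset.Ico 1 (G.vertexWeight (G.source e)),
            ∑ f ∈ G.outEdges (G.source e),
              G.realOp S K f i (G.ghostOp S K f k (G.nf S K v (rl g k :: w))) =
            if i = k then G.nf S K v (rl g k :: w) else 0 := by
          intro k hk
          obtain ⟨hk1, hk2⟩ := Finset.mem_Ico.1 hk
          rw [sum_realOp_ghostOp_nf_of_not_forb hS hk2,
            vertOp_nf_of_eq (show G.wsrc v (rl g k :: w) = G.source e from hs.symm)]
          rintro f - _ ⟨⟩ ⟨hk', -⟩
          lia
        have h3 : G.realOp S K g i (G.nf S K v w) = G.nf S K v (rl g i :: w) := by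
          refine realOp_nf fun y hy hy' => hw.2.2.1 y hy ?_
          match y, hy' with
          | gh _ _, hy' => exact hy'
        rw [Finset.sum_congr rfl h1, Finset.sum_sub_distrib, Finset.sum_ite_eq',
          if_pos (G.mem_outEdges.2 hs.symm), Finset.sum_comm, Finset.sum_congr rfl h2,
          Finset.sum_ite_eq, h3]
        rcases Nat.eq_zero_or_pos i with rfl | hi'
        · simp [vertOp_nf, show G.wsrc v (rl g 0 :: w) = G.source e from hs.symm]
        · rw [if_pos (Finset.mem_Ico.2 ⟨hi', hi⟩), sub_self, if_neg hi'.ne']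
          rfl
  · rw [LinearMap.sum_apply]
    rw [Finset.sum_eq_zero fun e _ => by
      rw [Module.End.mul_apply, ghostOp_single_of_not_normal h, map_zero]]
    split_ifs
    · rw [vertOp_single_of_not_normal h]
    · rfl

omit hS in
open Classical in
/-- The relation `∑ e_i* f_i = δ_{ef} r(e)` on words `w` for which no `f_i w` needs rewriting. -/
theorem sum_ghostOp_realOp_nf_of_not_forb {e f : E} {v : V} {w : List (Letter E)}
    (hef : G.source e = G.source f) (hw : ∀ y ∈ w.head?, ¬ G.Forb S (rl f 0) y) :
    ∑ i ∈ Finset.range (G.vertexWeight (G.source e)),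
        G.ghostOp S K e i (G.realOp S K f i (G.nf S K v w)) =
      if e = f then G.vertOp S K (G.range e) (G.nf S K v w) else 0 := by
  have hpos : 0 < G.vertexWeight (G.source e) :=
    (G.weight_pos e).trans_le (G.weight_le_vertexWeight e)
  have hw' (i : ℕ) : ∀ y ∈ w.head?, ¬ G.Forb S (rl f i) y := by
    intro y hy hy'
    refine hw y hy ?_
    match y, hy' with
    | gh _ _, hy' => exact hy'
  have h1 : ∀ i ∈ Finset.Ico 1 (G.vertexWeight (G.source e)),
      G.ghostOp S K e i (G.realOp S K f i (G.nf S K v w)) =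
        G.nf S K v (gh e i :: rl f i :: w) := by
    intro i hi
    rw [realOp_nf (hw' i), ghostOp_nf]
    rintro _ ⟨⟩ ⟨hi', -⟩
    exact absurd (Finset.mem_Ico.1 hi).1 (by simp [hi'])
  rw [Finset.range_eq_Ico, Finset.sum_eq_sum_Ico_succ_bot hpos, Finset.sum_congr rfl h1,
    realOp_nf hw]
  by_cases hn : G.Normal S v (rl f 0 :: w)
  · rw [ghostOp_nf_rl hef hn, sub_add_cancel, vertOp_nf]
    split_ifs with h h'
    · rfl
    · exact absurd (h ▸ hn.2.1.symm) h'
    · rfl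
  · have hn' (hwn : G.Normal S v w) : ¬ G.wsrc v w = G.range f := fun h =>
      hn ⟨G.weight_pos f, h.symm, hw, hwn⟩
    have h2 : G.vertOp S K (G.range f) (G.nf S K v w) = 0 := by
      by_cases hwn : G.Normal S v w
      · rw [vertOp_nf_of_ne (hn' hwn)]
      · rw [nf_of_not_normal hwn, map_zero]
    rw [nf_of_not_normal hn, map_zero, zero_add]
    rw [Finset.sum_eq_zero fun i _ => nf_of_not_normal fun h : G.Normal S v (_ :: rl f i :: w) =>
      hn' h.of_cons.of_cons h.of_cons.2.1.symm]
    split_ifs with h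
    · rw [h, h2]
    · rfl

open Classical in
theorem sum_ghostOp_mul_realOp {e f : E} (hef : G.source e = G.source f) :
    ∑ i ∈ Finset.range (G.vertexWeight (G.source e)), G.ghostOp S K e i * G.realOp S K f i =
      if e = f then G.vertOp S K (G.range e) else 0 := by
  refine end_ext (G := G) (S := S) (fun v w hw => ?_) fun v w h => ?_
  · rw [LinearMap.sum_apply]
    simp only [Module.End.mul_apply]
    by_cases hf : ∀ y ∈ w.head?, ¬ G.Forb S (rl f 0) y
    · rw [sum_ghostOp_realOp_nf_of_not_forb hef hf]
      split_ifs <;> rfl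
    · push Not at hf
      obtain ⟨y, hy, hf⟩ := hf
      match w, y, hy, hf, hw with
      | gh _ j :: w, _, rfl, ⟨rfl, hs⟩, hw =>
        -- Rewriting the forbidden pairs leaves words to which the previous case applies.
        have hj : j < G.vertexWeight (G.source e) :=
          hw.1.trans_le ((G.weight_le_vertexWeight f).trans_eq (by rw [hef]))
        have h0 : ∀ g ∈ (G.outEdges (G.source f)).erase f, ∀ i,
            ∀ y ∈ (gh g j :: w).head?, ¬ G.Forb S (rl g i) y := by
          rintro g hg i _ ⟨⟩ ⟨-, hs'⟩
          obtain ⟨hne, hg⟩ := Finset.mem_erase.1 hg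
          exact hne (by rw [← hs', hS.congr g f (G.mem_outEdges.1 hg), hs])
        have h1 (i : ℕ) : G.ghostOp S K e i (G.realOp S K f i (G.nf S K v (gh f j :: w))) =
            (if i = j then G.ghostOp S K e i (G.nf S K v w) else 0) -
            ∑ g ∈ (G.outEdges (G.source f)).erase f,
              G.ghostOp S K e i (G.realOp S K g i (G.nf S K v (gh g j :: w))) := by
          rw [realOp_nf_gh hs hw, map_sub, map_sum, apply_ite (G.ghostOp S K e i), map_zero]
          congr 1
          refine Finset.sum_congr rfl fun g hg => ?_
          rw [realOp_nf (h0 g hg i)]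
        have h2 : ∀ g ∈ (G.outEdges (G.source f)).erase f,
            ∑ i ∈ Finset.range (G.vertexWeight (G.source e)),
              G.ghostOp S K e i (G.realOp S K g i (G.nf S K v (gh g j :: w))) =
            if e = g then G.nf S K v (gh g j :: w) else 0 := by
          intro g hg
          have hg' := G.mem_outEdges.1 (Finset.mem_of_mem_erase hg)
          rw [sum_ghostOp_realOp_nf_of_not_forb (hef.trans hg'.symm) (h0 g hg 0)]
          split_ifs with h
          · rw [vertOp_nf_of_eq (h ▸ rfl)]
          · rfl
        have h3 : G.ghostOp S K e j (G.nf S K v w) = G.nf S K v (gh e j :: w) := by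
          refine ghostOp_nf fun y hy hy' => hw.2.2.1 y hy ?_
          match y, hy' with
          | rl _ _, ⟨h, h', h''⟩ => exact ⟨h, h', hef.symm.trans h''⟩
        simp only [h1]
        rw [Finset.sum_sub_distrib, Finset.sum_ite_eq', if_pos (Finset.mem_range.2 hj),
          Finset.sum_comm, Finset.sum_congr rfl h2, Finset.sum_ite_eq, h3]
        by_cases h : e = f
        · subst h
          rw [if_neg (Finset.notMem_erase _ _), sub_zero, if_pos rfl]
          exact (vertOp_nf_of_eq rfl).symm
        · rw [if_pos (Finset.mem_erase.2 ⟨h, G.mem_outEdges.2 hef⟩), sub_self, if_neg h]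
          rfl
  · rw [LinearMap.sum_apply]
    rw [Finset.sum_eq_zero fun e _ => by
      rw [Module.End.mul_apply, realOp_single_of_not_normal h, map_zero]]
    split_ifs
    · rw [vertOp_single_of_not_normal h]
    · rfl

open Classical in
theorem realOp_eq_zero {e : E} {i : ℕ} (hi : ¬ i < G.weight e) : G.realOp S K e i = 0 := by
  refine end_ext (G := G) (S := S) (fun v w hw => ?_) fun v w h => ?_
  · by_cases hf : ∀ y ∈ w.head?, ¬ G.Forb S (rl e i) y
    · rw [realOp_nf hf, nf_of_not_normal fun h : G.Normal S v (rl e i :: w) => hi h.1]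
      rfl
    · push Not at hf
      obtain ⟨y, hy, hf⟩ := hf
      match w, y, hy, hf, hw with
      | gh _ j :: w, _, rfl, ⟨rfl, hs⟩, hw =>
        rw [realOp_nf_gh hs hw, if_neg, Finset.sum_eq_zero, sub_zero]
        · rfl
        · intro g hg
          refine nf_of_not_normal fun h => hi (h.1.trans_le ?_)
          rw [← hs, hS.weight_eq, ← G.mem_outEdges.1 (Finset.mem_of_mem_erase hg)]
          exact G.weight_le_vertexWeight g
        · rintro rfl
          exact hi hw.1
  · rw [realOp_single_of_not_normal h]
    rfl

omit hS in
theorem ghostOp_eq_zero {e : E} {i : ℕ} (hi : ¬ i < G.weight e) : G.ghostOp S K e i = 0 := by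
  refine end_ext (G := G) (S := S) (fun v w hw => ?_) fun v w h => ?_
  · rw [ghostOp_nf, nf_of_not_normal fun h : G.Normal S v (gh e i :: w) => hi h.1]
    · rfl
    · intro y _ hf
      match y, hf with
      | rl _ _, hf => exact hi (hf.1 ▸ G.weight_pos e)
  · rw [ghostOp_single_of_not_normal h]
    rfl

end Leavitt

end WeightedGraph

/-! ### Homomorphisms out of the algebras -/

section Lift

variable {K : Type*} [Field K]

/-- A homomorphism that kills the relators `S` induces a homomorphism on the quotient by the ideal
generated by `S`. -/
def AlgQuotient.lift {A B : Type*} [NonUnitalRing A] [Module K A] [NonUnitalRing B] [Module K B]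
    (S : Set A) (φ : A →ₙₐ[K] B) (h : ∀ x ∈ S, φ x = 0) : AlgQuotient K S →ₙₐ[K] B :=
  have hle : algIdealGen K S ≤ LinearMap.ker (φ : A →ₗ[K] B) := by
    refine sInf_le ⟨fun x hx => h x hx, fun a x hx => ?_⟩
    have hx : φ x = 0 := hx
    constructor
    · change φ (a * x) = 0
      rw [map_mul, hx, mul_zero]
    · change φ (x * a) = 0
      rw [map_mul, hx, zero_mul]
  { (algIdealGen K S).liftQ (φ : A →ₗ[K] B) hle with
    map_zero' := map_zero ((algIdealGen K S).liftQ (φ : A →ₗ[K] B) hle)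
    map_mul' := by
      intro x y
      obtain ⟨a, rfl⟩ := AlgQuotient.mk_surjective K S x
      obtain ⟨b, rfl⟩ := AlgQuotient.mk_surjective K S y
      exact map_mul φ a b }

/-- The homomorphism from the free associative algebra that is given by the images of the
letters. -/
def FreeAssocAlg.lift {X B : Type*} [NonUnitalRing B] [Module K B] [IsScalarTower K B B]
    [SMulCommClass K B B] (φ : X → B) : FreeAssocAlg K X →ₙₐ[K] B :=
  MonoidAlgebra.liftMagma K (FreeSemigroup.lift φ)

theorem FreeAssocAlg.lift_letter {X B : Type*} [NonUnitalRing B] [Module K B]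
    [IsScalarTower K B B] [SMulCommClass K B B] (φ : X → B) (x : X) :
    FreeAssocAlg.lift φ (FreeAssocAlg.letter K x) = φ x := by
  simp [FreeAssocAlg.lift, FreeAssocAlg.letter, MonoidAlgebra.liftMagma]

/-- A subspace that contains all letters and is closed under left multiplication by letters is
the whole free associative algebra. -/
theorem FreeAssocAlg.eq_top_of_letter_mul {X : Type*} (N : Submodule K (FreeAssocAlg K X))
    (h : ∀ x, FreeAssocAlg.letter K x ∈ N)
    (hmul : ∀ x, ∀ a ∈ N, FreeAssocAlg.letter K x * a ∈ N) : N = ⊤ := by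
  have hw (w : FreeSemigroup X) : MonoidAlgebra.single w (1 : K) ∈ N := by
    induction w using FreeSemigroup.recOnMul with
    | ih1 x => exact h x
    | ih2 x w _ ih =>
      have := hmul x _ ih
      rwa [FreeAssocAlg.letter, MonoidAlgebra.single_mul_single, mul_one] at this
  rw [eq_top_iff]
  rintro a -
  induction a using MonoidAlgebra.induction_linear with
  | zero => exact N.zero_mem
  | add a b ha hb => exact N.add_mem ha hb
  | single w k =>
    have := N.smul_mem k (hw w)
    rwa [MonoidAlgebra.smul_single, smul_eq_mul, mul_one] at this

end Lift

namespace WeightedGraph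

variable {V E : Type*} (G : WeightedGraph V E) (S : E → E) (K : Type*) [Field K]

open Letter

/-! ### Generators and relations of the weighted Leavitt path algebra -/

/-- The vertex `v` in the weighted Leavitt path algebra. -/
def lpaVert (v : V) : G.LeavittPathAlgebra K := AlgQuotient.mk K _ (G.vert K v)

/-- The element `e_{i+1}` of the weighted Leavitt path algebra, zero if `i + 1 > w(e)`. -/
def lpaReal (e : E) (i : ℕ) : G.LeavittPathAlgebra K := AlgQuotient.mk K _ (G.real K e i)

/-- The element `e_{i+1}*` of the weighted Leavitt path algebra, zero if `i + 1 > w(e)`. -/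
def lpaGhost (e : E) (i : ℕ) : G.LeavittPathAlgebra K := AlgQuotient.mk K _ (G.ghost K e i)

variable {G S K}

theorem lpaReal_eq_zero {e : E} {i : ℕ} (h : ¬ i < G.weight e) : G.lpaReal K e i = 0 := by
  rw [lpaReal, WeightedGraph.real, dif_neg h, map_zero]

theorem lpaGhost_eq_zero {e : E} {i : ℕ} (h : ¬ i < G.weight e) : G.lpaGhost K e i = 0 := by
  rw [lpaGhost, WeightedGraph.ghost, dif_neg h, map_zero]

theorem pathAlgebra_eq_of_rel {a b : FreeAssocAlg K (V ⊕ ((Σ e : E, Fin (G.weight e)) ⊕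
    (Σ e : E, Fin (G.weight e))))} (h : G.hat.double.PathRel K (a - b)) :
    (AlgQuotient.mk K _ a : G.DPathAlgebra K) = AlgQuotient.mk K _ b :=
  (AlgQuotient.mk_eq_mk_iff K _ _ _).2 (subset_algIdealGen K _ h)

theorem lpa_eq_of_rel {a b : G.DPathAlgebra K} (h : G.LeavittRel K (a - b)) :
    (AlgQuotient.mk K _ a : G.LeavittPathAlgebra K) = AlgQuotient.mk K _ b :=
  (AlgQuotient.mk_eq_mk_iff K _ _ _).2 (subset_algIdealGen K _ h)

open Classical in
theorem lpaVert_mul_lpaVert (u v : V) :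
    G.lpaVert K u * G.lpaVert K v = if u = v then G.lpaVert K u else 0 := by
  have h := pathAlgebra_eq_of_rel (G := G) (K := K) (.vertex u v)
  have h' : G.vert K u * G.vert K v = if u = v then G.vert K u else 0 := by
    refine h.trans ?_
    split_ifs
    · rfl
    · rw [map_zero]
  rw [lpaVert, lpaVert, ← AlgQuotient.mk_mul, h']
  split_ifs
  · rfl
  · rw [map_zero]

theorem lpaVert_mul_lpaReal (e : E) (i : ℕ) :
    G.lpaVert K (G.source e) * G.lpaReal K e i = G.lpaReal K e i := by
  by_cases hi : i < G.weight e
  · have h := pathAlgebra_eq_of_rel (G := G) (K := K) (.source_mul (.inl ⟨e, ⟨i, hi⟩⟩))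
    rw [lpaReal, WeightedGraph.real, dif_pos hi]
    exact congrArg (AlgQuotient.mk K _) h
  · rw [lpaReal_eq_zero hi, mul_zero]

theorem lpaReal_mul_lpaVert (e : E) (i : ℕ) :
    G.lpaReal K e i * G.lpaVert K (G.range e) = G.lpaReal K e i := by
  by_cases hi : i < G.weight e
  · have h := pathAlgebra_eq_of_rel (G := G) (K := K) (.mul_range (.inl ⟨e, ⟨i, hi⟩⟩))
    rw [lpaReal, WeightedGraph.real, dif_pos hi]
    exact congrArg (AlgQuotient.mk K _) h
  · rw [lpaReal_eq_zero hi, zero_mul]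

theorem lpaVert_mul_lpaGhost (e : E) (i : ℕ) :
    G.lpaVert K (G.range e) * G.lpaGhost K e i = G.lpaGhost K e i := by
  by_cases hi : i < G.weight e
  · have h := pathAlgebra_eq_of_rel (G := G) (K := K) (.source_mul (.inr ⟨e, ⟨i, hi⟩⟩))
    rw [lpaGhost, WeightedGraph.ghost, dif_pos hi]
    exact congrArg (AlgQuotient.mk K _) h
  · rw [lpaGhost_eq_zero hi, mul_zero]

theorem lpaGhost_mul_lpaVert (e : E) (i : ℕ) :
    G.lpaGhost K e i * G.lpaVert K (G.source e) = G.lpaGhost K e i := by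
  by_cases hi : i < G.weight e
  · have h := pathAlgebra_eq_of_rel (G := G) (K := K) (.mul_range (.inr ⟨e, ⟨i, hi⟩⟩))
    rw [lpaGhost, WeightedGraph.ghost, dif_pos hi]
    exact congrArg (AlgQuotient.mk K _) h
  · rw [lpaGhost_eq_zero hi, zero_mul]

open Classical in
theorem sum_lpaReal_mul_lpaGhost {v : V} {i j : ℕ} (hi : i < G.vertexWeight v)
    (hj : j < G.vertexWeight v) :
    ∑ e ∈ G.outEdges v, G.lpaReal K e i * G.lpaGhost K e j =
      if i = j then G.lpaVert K v else 0 := by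
  have h := lpa_eq_of_rel (.real_ghost (G := G) (K := K) v i j hi hj)
  rw [map_sum] at h
  refine h.trans ?_
  split_ifs
  · rfl
  · rw [map_zero]

open Classical in
theorem sum_lpaGhost_mul_lpaReal {e f : E} (hef : G.source e = G.source f) :
    ∑ i ∈ Finset.range (G.vertexWeight (G.source e)), G.lpaGhost K e i * G.lpaReal K f i =
      if e = f then G.lpaVert K (G.range e) else 0 := by
  have h := lpa_eq_of_rel (.ghost_real (G := G) (K := K) (G.source e) e f
    (G.mem_outEdges.2 rfl) (G.mem_outEdges.2 hef.symm))
  rw [map_sum] at h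
  refine h.trans ?_
  split_ifs
  · rfl
  · rw [map_zero]

/-- A subspace that contains the generators and is closed under left multiplication by generators
is the whole algebra. -/
theorem lpa_eq_top_of_mul (N : Submodule K (G.LeavittPathAlgebra K))
    (hv : ∀ v, G.lpaVert K v ∈ N) (hr : ∀ e i, i < G.weight e → G.lpaReal K e i ∈ N)
    (hg : ∀ e i, i < G.weight e → G.lpaGhost K e i ∈ N)
    (hv' : ∀ v, ∀ a ∈ N, G.lpaVert K v * a ∈ N)
    (hr' : ∀ e i, i < G.weight e → ∀ a ∈ N, G.lpaReal K e i * a ∈ N)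
    (hg' : ∀ e i, i < G.weight e → ∀ a ∈ N, G.lpaGhost K e i * a ∈ N) : N = ⊤ := by
  let π : FreeAssocAlg K (V ⊕ ((Σ e : E, Fin (G.weight e)) ⊕ (Σ e : E, Fin (G.weight e)))) →ₗ[K]
      G.LeavittPathAlgebra K := AlgQuotient.mk K _ ∘ₗ AlgQuotient.mk K _
  have hreal (e : E) (i : Fin (G.weight e)) :
      π (FreeAssocAlg.letter K (.inr (.inl ⟨e, i⟩))) = G.lpaReal K e i := by
    rw [lpaReal, WeightedGraph.real, dif_pos i.2]
    rfl
  have hghost (e : E) (i : Fin (G.weight e)) :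
      π (FreeAssocAlg.letter K (.inr (.inr ⟨e, i⟩))) = G.lpaGhost K e i := by
    rw [lpaGhost, WeightedGraph.ghost, dif_pos i.2]
    rfl
  have h : N.comap π = ⊤ := by
    refine FreeAssocAlg.eq_top_of_letter_mul _ ?_ ?_
    · rintro (v | ⟨e, i⟩ | ⟨e, i⟩)
      · exact hv v
      · rw [Submodule.mem_comap, hreal]
        exact hr e i i.2
      · rw [Submodule.mem_comap, hghost]
        exact hg e i i.2
    · rintro (v | ⟨e, i⟩ | ⟨e, i⟩) a ha
      · exact hv' v _ ha
      · have := hr' e i i.2 _ ha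
        rwa [← hreal] at this
      · have := hg' e i i.2 _ ha
        rwa [← hghost] at this
  rw [eq_top_iff]
  rintro x -
  obtain ⟨y, rfl⟩ := AlgQuotient.mk_surjective K _ x
  obtain ⟨z, rfl⟩ := AlgQuotient.mk_surjective K _ y
  have hz : z ∈ N.comap π := h ▸ Submodule.mem_top
  exact hz

/-! ### The representation on words -/

variable (G S K) in
/-- The operators by which the generators of the free algebra act. -/
def genOp : V ⊕ ((Σ e : E, Fin (G.weight e)) ⊕ (Σ e : E, Fin (G.weight e))) →
    Module.End K (WordSpace K V E)
  | .inl v => G.vertOp S K v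
  | .inr (.inl x) => G.realOp S K x.1 x.2
  | .inr (.inr x) => G.ghostOp S K x.1 x.2

theorem lift_genOp_eq_zero {x : FreeAssocAlg K (V ⊕ ((Σ e : E, Fin (G.weight e)) ⊕
    (Σ e : E, Fin (G.weight e))))} (hx : G.hat.double.PathRel K x) :
    FreeAssocAlg.lift (G.genOp S K) x = 0 := by
  classical
  cases hx with
  | vertex v w =>
    rw [map_sub, map_mul, FreeAssocAlg.lift_letter, FreeAssocAlg.lift_letter, sub_eq_zero]
    refine (vertOp_mul_vertOp v w).trans ?_
    split_ifs
    · rw [FreeAssocAlg.lift_letter]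
      rfl
    · rw [map_zero]
  | source_mul x =>
    rw [map_sub, map_mul, FreeAssocAlg.lift_letter, FreeAssocAlg.lift_letter, sub_eq_zero]
    rcases x with x | x
    · exact vertOp_source_mul_realOp _ _
    · exact vertOp_range_mul_ghostOp _ _
  | mul_range x =>
    rw [map_sub, map_mul, FreeAssocAlg.lift_letter, FreeAssocAlg.lift_letter, sub_eq_zero]
    rcases x with x | x
    · exact realOp_mul_vertOp_range _ _
    · exact ghostOp_mul_vertOp_source _ _

variable (G S K) in
/-- The representation of the path algebra of the double graph on the space of words. -/
def pathRep : G.DPathAlgebra K →ₙₐ[K] Module.End K (WordSpace K V E) :=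
  AlgQuotient.lift {x | G.hat.double.PathRel K x} (FreeAssocAlg.lift (G.genOp S K))
    fun _ hx => lift_genOp_eq_zero hx

theorem pathRep_vert (v : V) : G.pathRep S K (G.vert K v) = G.vertOp S K v :=
  FreeAssocAlg.lift_letter _ _

section Rep

variable (hS : G.IsSpecialChoice S)

include hS in
theorem pathRep_real (e : E) (i : ℕ) : G.pathRep S K (G.real K e i) = G.realOp S K e i := by
  by_cases hi : i < G.weight e
  · rw [WeightedGraph.real, dif_pos hi]
    exact FreeAssocAlg.lift_letter _ _
  · rw [WeightedGraph.real, dif_neg hi, map_zero, realOp_eq_zero hS hi]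

theorem pathRep_ghost (e : E) (i : ℕ) : G.pathRep S K (G.ghost K e i) = G.ghostOp S K e i := by
  by_cases hi : i < G.weight e
  · rw [WeightedGraph.ghost, dif_pos hi]
    exact FreeAssocAlg.lift_letter _ _
  · rw [WeightedGraph.ghost, dif_neg hi, map_zero, ghostOp_eq_zero hi]

include hS in
theorem pathRep_eq_zero {x : G.DPathAlgebra K} (hx : G.LeavittRel K x) :
    G.pathRep S K x = 0 := by
  classical
  cases hx with
  | real_ghost v i j hi hj =>
    rw [map_sub, map_sum, sub_eq_zero]
    simp only [map_mul, pathRep_real hS, pathRep_ghost]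
    rw [sum_realOp_mul_ghostOp hS hi hj]
    split_ifs
    · rw [pathRep_vert]
    · rw [map_zero]
  | ghost_real v e f he hf =>
    rw [G.mem_outEdges] at he hf
    subst he
    rw [map_sub, map_sum, sub_eq_zero]
    simp only [map_mul, pathRep_real hS, pathRep_ghost]
    rw [sum_ghostOp_mul_realOp hS hf.symm]
    split_ifs
    · rw [pathRep_vert]
    · rw [map_zero]

variable (K) in
/-- The representation of the weighted Leavitt path algebra on the space of words. -/
def lpaRep : G.LeavittPathAlgebra K →ₙₐ[K] Module.End K (WordSpace K V E) :=
  AlgQuotient.lift (K := K) (B := Module.End K (WordSpace K V E)) {x | G.LeavittRel K x}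
    (G.pathRep S K) fun _ hx => pathRep_eq_zero hS hx

theorem lpaRep_vert (v : V) : lpaRep K hS (G.lpaVert K v) = G.vertOp S K v :=
  pathRep_vert v

theorem lpaRep_real (e : E) (i : ℕ) : lpaRep K hS (G.lpaReal K e i) = G.realOp S K e i :=
  pathRep_real hS e i

theorem lpaRep_ghost (e : E) (i : ℕ) : lpaRep K hS (G.lpaGhost K e i) = G.ghostOp S K e i :=
  pathRep_ghost e i

/-! ### Normal words form a basis -/

variable (G K) in
/-- The element of the algebra given by a letter. -/
def lpaLetter : Letter E → G.LeavittPathAlgebra K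
  | rl e i => G.lpaReal K e i
  | gh e i => G.lpaGhost K e i

variable (G K) in
/-- The element of the algebra given by a word that ends at `v`. -/
def lpaWord (v : V) : List (Letter E) → G.LeavittPathAlgebra K
  | [] => G.lpaVert K v
  | x :: w => G.lpaLetter K x * lpaWord v w

theorem lpaRep_letter_nf {x : Letter E} {v : V} {w : List (Letter E)}
    (h : ∀ y ∈ w.head?, ¬ G.Forb S x y) :
    lpaRep K hS (G.lpaLetter K x) (G.nf S K v w) = G.nf S K v (x :: w) := by
  obtain ⟨e, i⟩ | ⟨e, i⟩ := x
  · rw [lpaLetter, lpaRep_real, realOp_nf h]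
  · rw [lpaLetter, lpaRep_ghost, ghostOp_nf h]

/-- A normal word is read off from its action: it acts by concatenation whenever the result is
normal. -/
theorem lpaRep_word_nf {u v : V} {c w : List (Letter E)} (h : G.Normal S v (c ++ w))
    (hu : G.wsrc v w = u) :
    lpaRep K hS (G.lpaWord K u c) (G.nf S K v w) = G.nf S K v (c ++ w) := by
  induction c with
  | nil => rw [lpaWord, lpaRep_vert, vertOp_nf_of_eq hu, List.nil_append]
  | cons x c ih =>
    have h' : G.Normal S v (x :: (c ++ w)) := h
    rw [lpaWord, map_mul, Module.End.mul_apply, ih h'.of_cons, lpaRep_letter_nf hS h'.2.2.1,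
      List.cons_append]

theorem lpaRep_word_nf_of_ne {u v : V} {c w : List (Letter E)} (hu : G.wsrc v w ≠ u) :
    lpaRep K hS (G.lpaWord K u c) (G.nf S K v w) = 0 := by
  induction c with
  | nil => rw [lpaWord, lpaRep_vert, vertOp_nf_of_ne hu]
  | cons x c ih => rw [lpaWord, map_mul, Module.End.mul_apply, ih, map_zero]

theorem lpaRep_word_nf_nil {v : V} {w : List (Letter E)} (h : G.Normal S v w) :
    lpaRep K hS (G.lpaWord K v w) (G.nf S K v []) = Finsupp.single (v, w) 1 := by
  have h' : G.Normal S v (w ++ []) := by rwa [List.append_nil]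
  rw [lpaRep_word_nf (u := v) hS h' rfl, List.append_nil, nf_of_normal h]

include hS in
theorem linearIndependent_lpaWord :
    LinearIndependent K fun x : {x : V × List (Letter E) // G.Normal S x.1 x.2} =>
      G.lpaWord K x.1.1 x.1.2 := by
  -- The functional dual to `(v, w)` is the coefficient at `(v, w)` of the action on the trivial
  -- word `v`.
  rw [linearIndependent_iff']
  intro s g hg ⟨⟨v, w⟩, hw⟩ hi
  have h := congrArg (fun a => lpaRep K hS a (G.nf S K v []) (v, w)) hg
  simp only [map_sum, map_zero, LinearMap.sum_apply, map_smul, LinearMap.smul_apply,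
    LinearMap.zero_apply, Finsupp.coe_zero, Pi.zero_apply, Finsupp.finsetSum_apply,
    Finsupp.smul_apply] at h
  rw [Finset.sum_eq_single_of_mem _ hi] at h
  · dsimp only at h hw
    rw [lpaRep_word_nf_nil hS hw] at h
    simpa using h
  · rintro ⟨⟨v', w'⟩, hw'⟩ - hne
    dsimp only at hw' ⊢
    by_cases hv : v = v'
    · subst hv
      have hne' : w' ≠ w := by
        rintro rfl
        exact hne rfl
      rw [lpaRep_word_nf_nil hS hw']
      simp [hne']
    · rw [lpaRep_word_nf_of_ne hS (show G.wsrc v [] ≠ v' from hv)]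
      simp

variable (G S K) in
/-- The span of all normal words. -/
def normalSpan : Submodule K (G.LeavittPathAlgebra K) :=
  Submodule.span K (Set.range fun x : {x : V × List (Letter E) // G.Normal S x.1 x.2} =>
    G.lpaWord K x.1.1 x.1.2)

theorem lpaWord_mem_normalSpan {v : V} {w : List (Letter E)} (h : G.Normal S v w) :
    G.lpaWord K v w ∈ G.normalSpan S K :=
  Submodule.subset_span ⟨⟨(v, w), h⟩, rfl⟩

end Rep

end WeightedGraph

namespace WeightedGraph

variable {V E : Type*} {G : WeightedGraph V E} {S : E → E} {K : Type*} [Field K]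

open Letter

theorem lpaVert_mul_lpaLetter (x : Letter E) :
    G.lpaVert K (G.lsrc x) * G.lpaLetter K x = G.lpaLetter K x := by
  obtain ⟨e, i⟩ | ⟨e, i⟩ := x
  · exact lpaVert_mul_lpaReal e i
  · exact lpaVert_mul_lpaGhost e i

theorem lpaLetter_mul_lpaVert (x : Letter E) :
    G.lpaLetter K x * G.lpaVert K (G.ltgt x) = G.lpaLetter K x := by
  obtain ⟨e, i⟩ | ⟨e, i⟩ := x
  · exact lpaReal_mul_lpaVert e i
  · exact lpaGhost_mul_lpaVert e i

theorem lpaLetter_eq_zero {x : Letter E} (h : ¬ G.Valid x) : G.lpaLetter K x = 0 := by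
  obtain ⟨e, i⟩ | ⟨e, i⟩ := x
  · exact lpaReal_eq_zero h
  · exact lpaGhost_eq_zero h

theorem lpaVert_wsrc_mul_lpaWord (v : V) (w : List (Letter E)) :
    G.lpaVert K (G.wsrc v w) * G.lpaWord K v w = G.lpaWord K v w := by
  classical
  cases w with
  | nil => exact (lpaVert_mul_lpaVert v v).trans (if_pos rfl)
  | cons x w => rw [lpaWord, wsrc, ← mul_assoc, lpaVert_mul_lpaLetter]

theorem lpaVert_mul_lpaWord_of_ne {u v : V} {w : List (Letter E)} (h : u ≠ G.wsrc v w) :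
    G.lpaVert K u * G.lpaWord K v w = 0 := by
  classical
  rw [← lpaVert_wsrc_mul_lpaWord, ← mul_assoc, lpaVert_mul_lpaVert, if_neg h, zero_mul]

theorem lpaLetter_mul_lpaWord_of_ne {x : Letter E} {v : V} {w : List (Letter E)}
    (h : G.ltgt x ≠ G.wsrc v w) : G.lpaLetter K x * G.lpaWord K v w = 0 := by
  rw [← lpaLetter_mul_lpaVert, mul_assoc, lpaVert_mul_lpaWord_of_ne h, mul_zero]

/-- No rewriting is needed here: the product is a normal word, or it is zero because the letter does
not fit to the word or has too large an index. -/
theorem lpaLetter_mul_lpaWord_mem_of_not_forb {x : Letter E} {v : V} {w : List (Letter E)}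
    (hw : G.Normal S v w) (h : ∀ y ∈ w.head?, ¬ G.Forb S x y) :
    G.lpaLetter K x * G.lpaWord K v w ∈ G.normalSpan S K := by
  by_cases hx : G.Valid x
  · by_cases hxw : G.ltgt x = G.wsrc v w
    · exact lpaWord_mem_normalSpan (v := v) (w := x :: w) ⟨hx, hxw, h, hw⟩
    · rw [lpaLetter_mul_lpaWord_of_ne hxw]
      exact zero_mem _
  · rw [lpaLetter_eq_zero hx, zero_mul]
    exact zero_mem _

theorem lpaReal_mul_lpaGhost_mul_mem (hS : G.IsSpecialChoice S) {e : E} {i j : ℕ} {v : V}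
    {w : List (Letter E)} (hi : i < G.weight e) (hs : S e = e)
    (hw : G.Normal S v (gh e j :: w)) :
    G.lpaReal K e i * (G.lpaGhost K e j * G.lpaWord K v w) ∈ G.normalSpan S K := by
  classical
  have hj : j < G.weight e := hw.1
  have hwe := G.weight_le_vertexWeight e
  have hrel := sum_lpaReal_mul_lpaGhost (K := K) (hi.trans_le hwe) (hj.trans_le hwe)
  rw [← Finset.add_sum_erase _ _ (G.mem_outEdges.2 rfl), ← eq_sub_iff_add_eq] at hrel
  rw [← mul_assoc, hrel, sub_mul, Finset.sum_mul]
  refine sub_mem ?_ (sum_mem fun g hg => ?_)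
  · split_ifs
    · have hsrc : G.source e = G.wsrc v w := hw.2.1
      rw [hsrc, lpaVert_wsrc_mul_lpaWord]
      exact lpaWord_mem_normalSpan hw.of_cons
    · rw [zero_mul]
      exact zero_mem _
  · obtain ⟨hne, hg⟩ := Finset.mem_erase.1 hg
    rw [G.mem_outEdges] at hg
    rw [mul_assoc]
    by_cases hgj : j < G.weight g
    · refine lpaLetter_mul_lpaWord_mem_of_not_forb (x := rl g i) (w := gh g j :: w)
        ⟨hgj, hg.trans hw.2.1, fun y hy hy' => hw.2.2.1 y hy ?_, hw.of_cons⟩ ?_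
      · match y, hy' with
        | rl _ _, ⟨h, h', h''⟩ => exact ⟨h, h', hg.symm.trans h''⟩
      · rintro _ ⟨⟩ ⟨-, hs'⟩
        exact hne (by rw [← hs', hS.congr g e hg, hs])
    · rw [lpaGhost_eq_zero hgj, zero_mul, mul_zero]
      exact zero_mem _

theorem lpaGhost_mul_lpaReal_mul_mem {e f : E} {v : V} {w : List (Letter E)}
    (hef : G.source e = G.source f) (hw : G.Normal S v (rl f 0 :: w)) :
    G.lpaGhost K e 0 * (G.lpaReal K f 0 * G.lpaWord K v w) ∈ G.normalSpan S K := by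
  classical
  have hpos : 0 < G.vertexWeight (G.source e) :=
    (G.weight_pos e).trans_le (G.weight_le_vertexWeight e)
  have hrel := sum_lpaGhost_mul_lpaReal (K := K) hef
  rw [Finset.range_eq_Ico, Finset.sum_eq_sum_Ico_succ_bot hpos, ← eq_sub_iff_add_eq] at hrel
  rw [← mul_assoc, hrel, sub_mul, Finset.sum_mul]
  refine sub_mem ?_ (sum_mem fun k hk => ?_)
  · split_ifs with h
    · have hsrc : G.range e = G.wsrc v w := h ▸ hw.2.1
      rw [hsrc, lpaVert_wsrc_mul_lpaWord]
      exact lpaWord_mem_normalSpan hw.of_cons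
    · rw [zero_mul]
      exact zero_mem _
  · rw [mul_assoc]
    by_cases hfk : k < G.weight f
    · refine lpaLetter_mul_lpaWord_mem_of_not_forb (x := gh e k) (w := rl f k :: w)
        ⟨hfk, hw.2.1, fun y hy hy' => hw.2.2.1 y hy ?_, hw.of_cons⟩ ?_
      · match y, hy' with
        | gh _ _, hy' => exact hy'
      · rintro _ ⟨⟩ ⟨hk', -⟩
        exact absurd (Finset.mem_Ico.1 hk).1 (by simp [hk'])
    · rw [lpaReal_eq_zero hfk, zero_mul, mul_zero]
      exact zero_mem _

theorem lpaLetter_mul_lpaWord_mem (hS : G.IsSpecialChoice S) {x : Letter E} (hx : G.Valid x)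
    {v : V} {w : List (Letter E)} (hw : G.Normal S v w) :
    G.lpaLetter K x * G.lpaWord K v w ∈ G.normalSpan S K := by
  by_cases hf : ∀ y ∈ w.head?, ¬ G.Forb S x y
  · exact lpaLetter_mul_lpaWord_mem_of_not_forb hw hf
  · push Not at hf
    obtain ⟨y, hy, hf⟩ := hf
    match x, w, y, hy, hf, hw, hx with
    | rl e i, gh _ j :: w, _, rfl, ⟨rfl, hs⟩, hw, hx =>
      exact lpaReal_mul_lpaGhost_mul_mem hS hx hs hw
    | gh e _, rl f _ :: w, _, rfl, ⟨rfl, rfl, hef⟩, hw, hx =>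
      exact lpaGhost_mul_lpaReal_mul_mem hef hw

theorem lpaLetter_mul_mem_normalSpan (hS : G.IsSpecialChoice S) {x : Letter E} (hx : G.Valid x)
    {a : G.LeavittPathAlgebra K} (ha : a ∈ G.normalSpan S K) :
    G.lpaLetter K x * a ∈ G.normalSpan S K := by
  have hle : G.normalSpan S K ≤
      (G.normalSpan S K).comap (LinearMap.mulLeft K (G.lpaLetter K x)) := by
    refine Submodule.span_le.2 ?_
    rintro _ ⟨⟨⟨v, w⟩, hw⟩, rfl⟩
    exact lpaLetter_mul_lpaWord_mem hS hx hw
  exact hle ha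

theorem lpaVert_mul_mem_normalSpan (u : V)
    {a : G.LeavittPathAlgebra K} (ha : a ∈ G.normalSpan S K) :
    G.lpaVert K u * a ∈ G.normalSpan S K := by
  have hle : G.normalSpan S K ≤
      (G.normalSpan S K).comap (LinearMap.mulLeft K (G.lpaVert K u)) := by
    refine Submodule.span_le.2 ?_
    rintro _ ⟨⟨⟨v, w⟩, hw⟩, rfl⟩
    change G.lpaVert K u * G.lpaWord K v w ∈ G.normalSpan S K
    by_cases hu : u = G.wsrc v w
    · rw [hu, lpaVert_wsrc_mul_lpaWord]
      exact lpaWord_mem_normalSpan hw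
    · rw [lpaVert_mul_lpaWord_of_ne hu]
      exact zero_mem _
  exact hle ha

/-- The normal words span the algebra. -/
theorem normalSpan_eq_top (hS : G.IsSpecialChoice S) : G.normalSpan S K = ⊤ := by
  have hlet {x : Letter E} (hx : G.Valid x) : G.lpaLetter K x ∈ G.normalSpan S K := by
    rw [← lpaLetter_mul_lpaVert]
    exact lpaWord_mem_normalSpan (v := G.ltgt x) (w := [x]) ⟨hx, rfl, by simp, trivial⟩
  refine lpa_eq_top_of_mul _ (fun v => lpaWord_mem_normalSpan (v := v) (w := []) trivial)
    (fun e i hi => hlet (x := rl e i) hi) (fun e i hi => hlet (x := gh e i) hi)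
    (fun v a ha => lpaVert_mul_mem_normalSpan v ha)
    (fun e i hi a ha => lpaLetter_mul_mem_normalSpan hS (x := rl e i) hi ha)
    (fun e i hi a ha => lpaLetter_mul_mem_normalSpan hS (x := gh e i) hi ha)

/-! ### Finite-dimensionality -/

theorem Normal.valid_of_mem {v : V} {w : List (Letter E)} (hw : G.Normal S v w) {x : Letter E}
    (hx : x ∈ w) : G.Valid x := by
  induction w with
  | nil => simp at hx
  | cons y w ih =>
    rcases List.mem_cons.1 hx with rfl | hx
    · exact hw.1
    · exact ih hw.of_cons hx

theorem Normal.transGen {v : V} {x y : Letter E} {l l' : List (Letter E)}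
    (hw : G.Normal S v (x :: (l ++ y :: l'))) : Relation.TransGen (G.Allowed S) x y := by
  induction l generalizing x with
  | nil => exact .single hw.allowed
  | cons z l ih => exact .head hw.allowed (ih hw.of_cons)

theorem Normal.of_append {v : V} {l l' : List (Letter E)} (hw : G.Normal S v (l ++ l')) :
    G.Normal S v l' := by
  induction l with
  | nil => exact hw
  | cons x l ih => exact ih (Normal.of_cons hw)

theorem Normal.nodup (hno : ∀ x, ¬ Relation.TransGen (G.Allowed S) x x) {v : V}
    {w : List (Letter E)} (hw : G.Normal S v w) : w.Nodup := by
  by_contra h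
  rw [← List.map_id w] at h
  obtain ⟨l₁, x, l₂, y, l₃, rfl, rfl⟩ := List.exists_eq_append_of_not_nodup_map id h
  exact hno _ hw.of_append.transGen

variable (G) in
theorem finite_valid [Finite E] : {x : Letter E | G.Valid x}.Finite := by
  have h : {x : Letter E | G.Valid x} ⊆
      Set.range (fun x : Σ e : E, Fin (G.weight e) => rl x.1 x.2) ∪
        Set.range (fun x : Σ e : E, Fin (G.weight e) => gh x.1 x.2) := by
    rintro (⟨e, i⟩ | ⟨e, i⟩) hx
    · exact .inl ⟨⟨e, i, hx⟩, rfl⟩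
    · exact .inr ⟨⟨e, i, hx⟩, rfl⟩
  exact ((Set.finite_range _).union (Set.finite_range _)).subset h

theorem finite_normal [Finite V] [Finite E] (hno : ∀ x, ¬ Relation.TransGen (G.Allowed S) x x) :
    Finite {x : V × List (Letter E) // G.Normal S x.1 x.2} := by
  have : Finite {x : Letter E // G.Valid x} := G.finite_valid
  have := Fintype.ofFinite {x : Letter E // G.Valid x}
  have hfin : {w : List (Letter E) | ∃ v, G.Normal S v w}.Finite := by
    refine ((List.finite_length_le {x : Letter E // G.Valid x}
      (Fintype.card {x : Letter E // G.Valid x})).image (List.map Subtype.val)).subset ?_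
    rintro w ⟨v, hw⟩
    refine ⟨w.pmap Subtype.mk fun x hx => hw.valid_of_mem hx, ?_, by simp [List.map_pmap]⟩
    refine List.Nodup.length_le_card (List.Nodup.pmap ?_ (hw.nodup hno))
    intro x _ y _ h
    exact congrArg Subtype.val h
  refine ((Set.finite_univ (α := V)).prod hfin).subset ?_
  rintro ⟨v, w⟩ hw
  exact ⟨trivial, v, hw⟩

theorem finiteDimensional_of_no_closed_walk [Finite V] [Finite E] (hS : G.IsSpecialChoice S)
    (hno : ∀ x, ¬ Relation.TransGen (G.Allowed S) x x) :
    FiniteDimensional K (G.LeavittPathAlgebra K) := by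
  have := finite_normal hno
  refine ⟨?_⟩
  rw [← normalSpan_eq_top hS]
  exact Submodule.fg_span (Set.finite_range _)

theorem finite_of_finiteDimensional [FiniteDimensional K (G.LeavittPathAlgebra K)] :
    Finite V ∧ Finite E := by
  obtain ⟨S, hS⟩ := G.exists_isSpecialChoice
  have := (linearIndependent_lpaWord (K := K) hS).finite
  constructor
  · refine Finite.of_injective (β := {x : V × List (Letter E) // G.Normal S x.1 x.2})
      (fun v => ⟨(v, []), trivial⟩) fun v w h => ?_
    exact congrArg (fun x => x.1.1) h
  · refine Finite.of_injective (β := {x : V × List (Letter E) // G.Normal S x.1 x.2})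
      (fun e => ⟨(G.range e, [rl e 0]), ⟨G.weight_pos e, rfl, by simp, trivial⟩⟩) fun e f h => ?_
    simpa using congrArg (fun x => x.1.2) h

end WeightedGraph

/-! ### Growth and Gelfand-Kirillov dimension -/

section Growth

variable {K A : Type*} [Field K] [NonUnitalRing A] [Module K A] [IsScalarTower K A A]
  [SMulCommClass K A A]

open Filter Topology

theorem GKdim_eq_zero_of_finiteDimensional [FiniteDimensional K A] : GKdim K A = 0 := by
  have h (U : Submodule K A) :
      limsup (fun n : ℕ => ((Real.log (growth K U n) / Real.log n : ℝ) : EReal)) atTop = 0 := by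
    have hbound (n : ℕ) : Real.log (growth K U n) ≤ Real.log (Module.finrank K A) := by
      rcases Nat.eq_zero_or_pos (growth K U n) with h0 | hpos
      · rw [h0, Nat.cast_zero, Real.log_zero]
        exact Real.log_natCast_nonneg _
      · exact Real.log_le_log (by exact_mod_cast hpos)
          (by exact_mod_cast (Submodule.finrank_le _ : growth K U n ≤ _))
    have hlim : Tendsto (fun n : ℕ => Real.log (growth K U n) / Real.log n) atTop (𝓝 0) := by
      refine squeeze_zero
        (fun n => div_nonneg (Real.log_natCast_nonneg _) (Real.log_natCast_nonneg _))
        (fun n => div_le_div_of_nonneg_right (hbound n) (Real.log_natCast_nonneg n)) ?_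
      exact tendsto_const_nhds.div_atTop (Real.tendsto_log_atTop.comp tendsto_natCast_atTop_atTop)
    exact ((continuous_coe_real_ereal.tendsto 0).comp hlim).limsup_eq
  have : Nonempty {U : Submodule K A // FiniteDimensional K U} := ⟨⟨⊥, inferInstance⟩⟩
  rw [GKdim]
  simp only [h, ciSup_const]

theorem one_le_GKdim_of_le_growth {U : Submodule K A} [FiniteDimensional K U]
    (h : ∀ n, n ≤ growth K U n) : 1 ≤ GKdim K A := by
  refine le_trans ?_ (le_iSup (fun U : {U : Submodule K A // FiniteDimensional K U} =>
    limsup (fun n : ℕ => ((Real.log (growth K U.1 n) / Real.log n : ℝ) : EReal)) atTop)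
      ⟨U, inferInstance⟩)
  rw [← limsup_const (f := atTop (α := ℕ)) (1 : EReal)]
  refine limsup_le_limsup ?_
  filter_upwards [eventually_ge_atTop 2] with n hn
  have hn' : (1 : ℝ) < n := by exact_mod_cast hn
  have h1 : (1 : ℝ) ≤ Real.log (growth K U n) / Real.log n := by
    rw [one_le_div (Real.log_pos hn')]
    exact Real.log_le_log (by linarith) (by exact_mod_cast h n)
  exact_mod_cast h1

/-- The powers `a, a ^ 2, a ^ 3, …` in a ring without unit; `npowSucc a n` is `a ^ (n + 1)`. -/
def npowSucc (a : A) : ℕ → A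
  | 0 => a
  | n + 1 => npowSucc a n * a

theorem powSubspace_span_singleton (a : A) (n : ℕ) :
    powSubspace K (Submodule.span K {a}) n = Submodule.span K {npowSucc a n} := by
  induction n with
  | zero => rfl
  | succ n ih =>
    rw [powSubspace, ih, Submodule.map₂_span_span, Set.image2_singleton]
    rfl

theorem growth_span_singleton {a : A} (h : LinearIndependent K (npowSucc a)) (n : ℕ) :
    growth K (Submodule.span K {a}) n = n := by
  have h' : LinearIndependent K fun i : Fin n => npowSucc a i :=
    h.comp _ Fin.val_injective
  have hsup : (⨆ i : Fin n, powSubspace K (Submodule.span K {a}) i) =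
      Submodule.span K (Set.range fun i : Fin n => npowSucc a i) := by
    simp only [powSubspace_span_singleton, Submodule.span_range_eq_iSup]
  rw [growth, hsup, finrank_span_eq_card h', Fintype.card_fin]

/-- If the powers of an element are linearly independent, the algebra has at least linear
growth. -/
theorem one_le_GKdim_of_linearIndependent {a : A} (h : LinearIndependent K (npowSucc a)) :
    1 ≤ GKdim K A :=
  one_le_GKdim_of_le_growth fun n => (growth_span_singleton h n).ge

end Growth

namespace WeightedGraph

variable {V E : Type*} {G : WeightedGraph V E} {S : E → E} {K : Type*} [Field K]

open Letter

theorem exists_normal_of_transGen {x y : Letter E} (h : Relation.TransGen (G.Allowed S) x y) :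
    ∃ c, ∀ v w, G.Normal S v (y :: w) → G.Normal S v (x :: (c ++ y :: w)) := by
  induction h using Relation.TransGen.head_induction_on with
  | single h => exact ⟨[], fun v w hw => hw.cons_of_allowed h⟩
  | head h _ ih =>
    obtain ⟨c, hc⟩ := ih
    exact ⟨_ :: c, fun v w hw => (hc v w hw).cons_of_allowed h⟩

/-- The powers of the word along a closed walk are normal, hence linearly independent. -/
theorem one_le_GKdim_of_closed_walk (hS : G.IsSpecialChoice S) {x : Letter E}
    (h : Relation.TransGen (G.Allowed S) x x) : 1 ≤ GKdim K (G.LeavittPathAlgebra K) := by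
  obtain ⟨c, hc⟩ := exists_normal_of_transGen h
  let a := G.lpaWord K (G.lsrc x) (x :: c)
  let v := G.ltgt x
  have hx : G.Normal S v [x] := by
    obtain ⟨y, hy, -⟩ := Relation.TransGen.head'_iff.1 h
    exact ⟨hy.1, rfl, by simp, trivial⟩
  have ht (n : ℕ) {w : List (Letter E)} (hw : G.Normal S v (x :: w)) :
      G.Normal S v (x :: (fun w => c ++ x :: w)^[n] w) := by
    induction n generalizing w with
    | zero => exact hw
    | succ n ih => exact ih (hc v w hw)
  have hrep (n : ℕ) {w : List (Letter E)} (hw : G.Normal S v (x :: w)) :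
      lpaRep K hS (npowSucc a n) (G.nf S K v (x :: w)) =
        G.nf S K v (x :: (fun w => c ++ x :: w)^[n + 1] w) := by
    have ha {w : List (Letter E)} (hw : G.Normal S v (x :: w)) :
        lpaRep K hS a (G.nf S K v (x :: w)) = G.nf S K v (x :: (c ++ x :: w)) :=
      lpaRep_word_nf hS (c := x :: c) (w := x :: w) (hc v w hw) rfl
    induction n generalizing w with
    | zero => exact ha hw
    | succ n ih => rw [npowSucc, map_mul, Module.End.mul_apply, ha hw, ih (hc v w hw)]; rfl
  have hlen (n : ℕ) (w : List (Letter E)) :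
      ((fun w => c ++ x :: w)^[n] w).length = n * (c.length + 1) + w.length := by
    induction n generalizing w with
    | zero => simp
    | succ n ih =>
      rw [Function.iterate_succ_apply, ih]
      simp only [List.length_append, List.length_cons]
      ring
  have hinj : Function.Injective
      fun n : ℕ => (v, x :: (fun w => c ++ x :: w)^[n + 1] ([] : List (Letter E))) := by
    intro m n hmn
    have := congrArg (fun y => y.2.tail.length) hmn
    simp only [List.tail_cons, hlen] at this
    have := Nat.eq_of_mul_eq_mul_right (Nat.succ_pos _) (Nat.add_right_cancel this)
    lia
  let ψ : G.LeavittPathAlgebra K →ₗ[K] WordSpace K V E :=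
    LinearMap.applyₗ (G.nf S K v [x]) ∘ₗ
      (lpaRep K hS : G.LeavittPathAlgebra K →ₗ[K] Module.End K (WordSpace K V E))
  refine one_le_GKdim_of_linearIndependent (a := a) (LinearIndependent.of_comp ψ ?_)
  have hψ : ψ ∘ npowSucc a = fun n : ℕ =>
      Finsupp.single (v, x :: (fun w => c ++ x :: w)^[n + 1] []) (1 : K) := by
    funext n
    rw [← nf_of_normal (ht (n + 1) hx)]
    exact hrep n hx
  rw [hψ]
  exact (Finsupp.linearIndependent_single_one K _).comp _ hinj

end WeightedGraph

end

theorem mainTheorem5 {K V E : Type*} [Field K] [Nonempty V] (G : WeightedGraph V E) :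
    List.TFAE [
      FiniteDimensional K (G.LeavittPathAlgebra K),
      (Finite V ∧ Finite E) ∧ G.Acyclic ∧ G.WellBehaved,
      (Finite V ∧ Finite E) ∧ GKdim K (G.LeavittPathAlgebra K) = 0] := by
  obtain ⟨S, hS⟩ := G.exists_isSpecialChoice
  tfae_have 1 → 3 := fun _ =>
    ⟨WeightedGraph.finite_of_finiteDimensional (G := G) (K := K),
      GKdim_eq_zero_of_finiteDimensional⟩
  tfae_have 3 → 2 := by
    rintro ⟨hfin, hGK⟩
    have hno (x : WeightedGraph.Letter E) : ¬ Relation.TransGen (G.Allowed S) x x := by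
      intro h
      have h1 := WeightedGraph.one_le_GKdim_of_closed_walk (K := K) hS h
      rw [hGK] at h1
      exact absurd h1 (not_le.2 zero_lt_one)
    exact ⟨hfin, WeightedGraph.acyclic_of_no_closed_walk hno,
      WeightedGraph.wellBehaved_of_no_closed_walk hno hS⟩
  tfae_have 2 → 1 := by
    rintro ⟨⟨_, _⟩, hG, hW⟩
    exact WeightedGraph.finiteDimensional_of_no_closed_walk hS
      (WeightedGraph.no_closed_walk_of_wellBehaved hG hW hS)
  tfae_finish
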